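/- Let $n$ be a natural number and let $\mathfrak{o}_{2n}$ be the Lie algebra of skew-symmetric complex $2n\times 2n$ matrices, with elements $F_{ij}=E_{ij}-E_{ji}$ and invariant form $\langle X,Y\rangle=\tfrac12\operatorname{tr}XY$. Let $\widehat{\mathfrak o}_{2n}=\mathfrak{o}_{2n}[t,t^{-1}]\oplus\mathbb{C}K$ be the affine Kac–Moody algebra, where $K$ is central and, for $X[r]=Xt^r$, $$[X[r],Y[s]]=[X,Y][r+s]+r\,\delta_{r,-s}\langle X,Y\rangle K .$$ Let $V(\widehat{\mathfrak o}_{2n})$ be the vacuum module at the critical level, i.e. the quotient of $\mathrm U(\widehat{\mathfrak o}_{2n})$ by the left ideal generated by $\mathfrak{o}_{2n}[t]$ and $K+2n-2$, and let $\mathfrak z(\widehat{\mathfrak o}_{2n})=\{v\in V(\widehat{\mathfrak o}_{2n})\mid \mathfrak{o}_{2n}[t]\,v=0\}$ be the Feigin–Frenkel center. Let $\mathrm U_{\rm crit}=\mathrm U(\widehat{\mathfrak o}_{2n})/(K+2n-2)$ and let $\widetilde{\mathrm U}_{\rm crit}=\varprojlim_N \mathrm U_{\rm crit}/\mathrm U_{\rm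 crit}\,t^N\mathfrak{o}_{2n}[t]$ be its completion, a topological algebra. For a $2n\times 2n$ matrix $M=[M_{ij}]$ put $$\operatorname{Pf}M=\frac1{2^n n!}\sum_{\sigma\in\mathfrak S_{2n}}\operatorname{sgn}\sigma\cdot M_{\sigma(1)\sigma(2)}\cdots M_{\sigma(2n-1)\sigma(2n)} .$$ Set $F_{ij}(z)=\sum_{r\in\mathbb Z}F_{ij}[r]z^{-r-1}$ and $F_{ij}(z)_+=\sum_{r<0}F_{ij}[r]z^{-r-1}$, and expand $$\operatorname{Pf}[F_{ij}(z)]=\sum_{p\in\mathbb Z}S_p\,z^{-p-1},\qquad \operatorname{Pf}[F_{ij}(z)_+]=\sum_{p<0}S^+_p\,z^{-p-1},$$ with $S_p\in\widetilde{\mathrm U}_{\rm crit}$ and $S_p^+\in\mathrm U(\widehat{\mathfrak o}_{2n})$. Then: 1. If $\{i,j\}\cap\{k,l\}=\varnothing$, then $[F_{ij}[r],F_{kl}[s]]=0$ for all $r,s\in\mathbb Z$ (so the order of the factors in each product is irrelevant and no normal ordering is needed), and for all $\sigma$ and $p$ the infinite sum defining the coefficient of $z^{-p-1}$ in $F_{\sigma(1)\sigma(2)}(z)\cdots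 F_{\sigma(2n-1)\sigma(2n)}(z)$ converges (unconditionally) in $\widetilde{\mathrm U}_{\rm crit}$; thus the $S_p$ are well defined. 2. Every $S_p$, $p\in\mathbb Z$, is a Sugawara operator for $\widehat{\mathfrak o}_{2n}$: it commutes in $\widetilde{\mathrm U}_{\rm crit}$ with (the image of) every element of $\widehat{\mathfrak o}_{2n}$. 3. For every $p<0$, the image of $S^+_p$ in $V(\widehat{\mathfrak o}_{2n})$ lies in $\mathfrak z(\widehat{\mathfrak o}_{2n})$. -/

import Mathlib

noncomputable section

namespace PfaffianSugawara

open LieAlgebra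
open scoped TensorProduct

/-! ### Affine Lie algebras -/

theorem neg_lieInvariant {g : Type*} [LieRing g] [LieAlgebra ℂ g] (Φ : LinearMap.BilinForm ℂ g)
    (hi : Φ.lieInvariant g) : (-Φ).lieInvariant g := by
  intro X Y Z
  simp [hi X Y Z]

/-- The 2-cocycle `(X t^r, Y t^s) ↦ r δ_{r,-s} ⟨X, Y⟩` on the loop algebra `g[t, t⁻¹]`. The
sign is there because Mathlib's residue pairing is `(f, g) ↦ Res f dg`. -/
def affineCocycle {g : Type*} [LieRing g] [LieAlgebra ℂ g] (Φ : LinearMap.BilinForm ℂ g)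
    (hi : Φ.lieInvariant g) (hs : Φ.IsSymm) : LieModule.Cohomology.twoCocycle ℂ (loopAlgebra ℂ ℤ g)
    (TrivialLieModule ℂ (loopAlgebra ℂ ℤ g) ℂ) :=
  LoopAlgebra.twoCocycleOfBilinear ℂ ℤ g (-Φ) (neg_lieInvariant Φ hi) hs.neg

/-- The affine Lie algebra `g[t, t⁻¹] ⊕ ℂ K` of a Lie algebra `g` with a symmetric invariant
bilinear form `Φ`. -/
def AffineLie {g : Type*} [LieRing g] [LieAlgebra ℂ g] (Φ : LinearMap.BilinForm ℂ g)
    (hi : Φ.lieInvariant g) (hs : Φ.IsSymm) : Type _ := LieAlgebra.ofTwoCocycle (affineCocycle Φ hi hs)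

instance {g : Type*} [LieRing g] [LieAlgebra ℂ g] (Φ : LinearMap.BilinForm ℂ g)
    (hi : Φ.lieInvariant g) (hs : Φ.IsSymm) : LieRing (AffineLie Φ hi hs) :=
  inferInstanceAs (LieRing (LieAlgebra.ofTwoCocycle (affineCocycle Φ hi hs)))

instance {g : Type*} [LieRing g] [LieAlgebra ℂ g] (Φ : LinearMap.BilinForm ℂ g)
    (hi : Φ.lieInvariant g) (hs : Φ.IsSymm) : LieAlgebra ℂ (AffineLie Φ hi hs) :=
  inferInstanceAs (LieAlgebra ℂ (LieAlgebra.ofTwoCocycle (affineCocycle Φ hi hs)))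

/-- The element `f + c K`. -/
def affineMk {g : Type*} [LieRing g] [LieAlgebra ℂ g] (Φ : LinearMap.BilinForm ℂ g)
    (hi : Φ.lieInvariant g) (hs : Φ.IsSymm) : (loopAlgebra ℂ ℤ g × ℂ) ≃ₗ[ℂ] AffineLie Φ hi hs where
  toFun x := ofProd (affineCocycle Φ hi hs) (x.1, (TrivialLieModule.equiv ℂ _ ℂ).symm x.2)
  invFun x := (((ofProd (affineCocycle Φ hi hs)).symm x).1,
    TrivialLieModule.equiv ℂ _ ℂ ((ofProd (affineCocycle Φ hi hs)).symm x).2)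
  map_add' _ _ := rfl
  map_smul' _ _ := rfl
  left_inv _ := rfl
  right_inv _ := rfl

theorem affineMk_lie {g : Type*} [LieRing g] [LieAlgebra ℂ g] (Φ : LinearMap.BilinForm ℂ g)
    (hi : Φ.lieInvariant g) (hs : Φ.IsSymm) (x y : loopAlgebra ℂ ℤ g) (a b : ℂ) :
    ⁅affineMk Φ hi hs (x, a), affineMk Φ hi hs (y, b)⁆ =
      affineMk Φ hi hs (⁅x, y⁆, LoopAlgebra.residuePairing ℂ ℤ g (-Φ) x y) := by
  refine (bracket_ofTwoCocycle (c := affineCocycle Φ hi hs) _ _).trans ?_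
  refine congrArg (ofProd (affineCocycle Φ hi hs)) (Prod.ext rfl ?_)
  change (affineCocycle Φ hi hs).1 x y + 0 - 0 = _
  rw [add_zero, sub_zero]
  rfl

/-- The element `X[r] = X t^r`. -/
def affineLoop {g : Type*} [LieRing g] [LieAlgebra ℂ g] (Φ : LinearMap.BilinForm ℂ g)
    (hi : Φ.lieInvariant g) (hs : Φ.IsSymm) (X : g) (r : ℤ) : AffineLie Φ hi hs :=
  affineMk Φ hi hs (AddMonoidAlgebra.single r 1 ⊗ₜ[ℂ] X, 0)

/-- The central element `K`. -/
def affineK {g : Type*} [LieRing g] [LieAlgebra ℂ g] (Φ : LinearMap.BilinForm ℂ g)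
    (hi : Φ.lieInvariant g) (hs : Φ.IsSymm) : AffineLie Φ hi hs := affineMk Φ hi hs (0, 1)

theorem affineK_lie {g : Type*} [LieRing g] [LieAlgebra ℂ g] (Φ : LinearMap.BilinForm ℂ g)
    (hi : Φ.lieInvariant g) (hs : Φ.IsSymm) (x : AffineLie Φ hi hs) : ⁅affineK Φ hi hs, x⁆ = 0 := by
  obtain ⟨⟨y, b⟩, rfl⟩ := (affineMk Φ hi hs).surjective x
  rw [affineK, affineMk_lie, map_zero, LinearMap.zero_apply]
  have h : (⁅(0 : loopAlgebra ℂ ℤ g), y⁆, (0 : ℂ)) = 0 := Prod.ext (zero_lie y) rfl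
  exact (congrArg (affineMk Φ hi hs) h).trans (map_zero _)

theorem affineLoop_lie {g : Type*} [LieRing g] [LieAlgebra ℂ g] (Φ : LinearMap.BilinForm ℂ g)
    (hi : Φ.lieInvariant g) (hs : Φ.IsSymm) (X Y : g) (r s : ℤ) :
    ⁅affineLoop Φ hi hs X r, affineLoop Φ hi hs Y s⁆ =
      affineLoop Φ hi hs ⁅X, Y⁆ (r + s) + (if r = -s then (r : ℂ) * Φ X Y else 0) •
        affineK Φ hi hs := by
  rw [affineLoop, affineLoop, affineLoop, affineK, affineMk_lie, ← map_smul, ← map_add]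
  congr 1
  refine Prod.ext ?_ ?_
  · refine (LieAlgebra.ExtendScalars.bracket_tmul _ _ _ _ _ _ _ _).trans ?_
    rw [AddMonoidAlgebra.single_mul_single, one_mul]
    change _ = _ + _ • (0 : loopAlgebra ℂ ℤ g)
    rw [smul_zero, add_zero]
  · rw [LoopAlgebra.residuePairing_apply_apply, LoopAlgebra.toFinsupp_single_tmul,
      LoopAlgebra.toFinsupp_single_tmul, Finsupp.sum_single_index (by simp)]
    split_ifs with h
    · subst h
      simp
    · rw [Finsupp.single_eq_of_ne (by omega)]
      simp

theorem affine_induction {g : Type*} [LieRing g] [LieAlgebra ℂ g] (Φ : LinearMap.BilinForm ℂ g)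
    (hi : Φ.lieInvariant g) (hs : Φ.IsSymm) {p : AffineLie Φ hi hs → Prop} (hK : p (affineK Φ hi hs))
    (hloop : ∀ X r, p (affineLoop Φ hi hs X r)) (hadd : ∀ x y, p x → p y → p (x + y))
    (hsmul : ∀ (c : ℂ) x, p x → p (c • x)) (x : AffineLie Φ hi hs) : p x := by
  have h0 : p 0 := by simpa using hsmul 0 _ hK
  have h1 : ∀ y : loopAlgebra ℂ ℤ g, p (affineMk Φ hi hs (y, 0)) := by
    intro y
    induction y using TensorProduct.induction_on with
    | zero => rw [← Prod.zero_eq_mk, map_zero]; exact h0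
    | tmul f X =>
      induction f using AddMonoidAlgebra.induction_linear with
      | zero => rw [TensorProduct.zero_tmul, ← Prod.zero_eq_mk, map_zero]; exact h0
      | add f f' hf hf' =>
        have := hadd _ _ hf hf'
        rwa [← map_add, Prod.mk_add_mk, ← TensorProduct.add_tmul, add_zero] at this
      | single r c =>
        have := hsmul c _ (hloop X r)
        rw [affineLoop, ← map_smul, Prod.smul_mk, smul_zero, TensorProduct.smul_tmul'] at this
        rwa [AddMonoidAlgebra.smul_single, smul_eq_mul, mul_one] at this
    | add y y' hy hy' =>
      have := hadd _ _ hy hy'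
      rwa [← map_add, Prod.mk_add_mk, add_zero] at this
  obtain ⟨⟨y, b⟩, rfl⟩ := (affineMk Φ hi hs).surjective x
  have := hadd _ _ (h1 y) (hsmul b _ hK)
  rw [affineK, ← map_smul, ← map_add] at this
  simpa using this

/-! ### The affine Kac--Moody algebra of type `D` -/

attribute [local instance] LieRing.ofAssociativeRing

/-- The orthogonal Lie algebra `𝔬_{2n}` of skew-symmetric complex matrices of size `2n`. -/
def so2 (n : ℕ) : Type := Orthogonal.so (Fin (2 * n)) ℂ

instance (n : ℕ) : LieRing (so2 n) := inferInstanceAs (LieRing (Orthogonal.so (Fin (2 * n)) ℂ))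

instance (n : ℕ) : LieAlgebra ℂ (so2 n) :=
  inferInstanceAs (LieAlgebra ℂ (Orthogonal.so (Fin (2 * n)) ℂ))

/-- The matrix of an element of `𝔬_{2n}`. -/
def toMat (n : ℕ) : so2 n →ₗ[ℂ] Matrix (Fin (2 * n)) (Fin (2 * n)) ℂ :=
  (Orthogonal.so (Fin (2 * n)) ℂ).toSubmodule.subtype

theorem toMat_lie (n : ℕ) (X Y : so2 n) :
    toMat n ⁅X, Y⁆ = toMat n X * toMat n Y - toMat n Y * toMat n X := rfl

theorem toMat_injective (n : ℕ) : Function.Injective (toMat n) := Subtype.val_injective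

/-- The element `F_{ij} = E_{ij} - E_{ji}` of `𝔬_{2n}`. -/
def Fmat (n : ℕ) (i j : Fin (2 * n)) : so2 n :=
  ⟨Matrix.single i j 1 - Matrix.single j i 1, by
    rw [Orthogonal.mem_so]
    simp [Matrix.transpose_sub, Matrix.transpose_single]⟩

theorem toMat_Fmat (n : ℕ) (i j : Fin (2 * n)) :
    toMat n (Fmat n i j) = Matrix.single i j 1 - Matrix.single j i 1 := rfl

/-- The normalized invariant form `⟨X, Y⟩ = ½ tr (X Y)` on `𝔬_{2n}`. -/
def form (n : ℕ) : LinearMap.BilinForm ℂ (so2 n) :=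
  LinearMap.mk₂ ℂ (fun X Y => (1 / 2 : ℂ) * Matrix.trace (toMat n X * toMat n Y))
    (fun X X' Y => by simp [add_mul, mul_add])
    (fun c X Y => by simp; ring)
    (fun X Y Y' => by simp [mul_add])
    (fun c X Y => by simp; ring)

theorem form_apply (n : ℕ) (X Y : so2 n) :
    form n X Y = (1 / 2 : ℂ) * Matrix.trace (toMat n X * toMat n Y) := rfl

theorem form_symm (n : ℕ) : (form n).IsSymm := by
  refine ⟨fun X Y => ?_⟩
  simp [form_apply, Matrix.trace_mul_comm (toMat n X)]

theorem form_invariant (n : ℕ) : (form n).lieInvariant (so2 n) := by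
  intro X Y Z
  simp only [form_apply, toMat_lie, sub_mul, mul_sub, Matrix.trace_sub, Matrix.mul_assoc]
  rw [Matrix.trace_mul_comm (toMat n X)]
  simp only [Matrix.mul_assoc]
  ring

/-- The affine Kac--Moody algebra `𝔬_{2n}[t, t⁻¹] ⊕ ℂ K`. -/
abbrev Affine (n : ℕ) : Type := AffineLie (form n) (form_invariant n) (form_symm n)

/-- The element `X[r] = X t^r`. -/
abbrev loopElt (n : ℕ) (X : so2 n) (r : ℤ) : Affine n := affineLoop _ _ _ X r

/-- The central element `K`. -/
abbrev K (n : ℕ) : Affine n := affineK _ _ _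

/-- The universal enveloping algebra of the affine algebra. -/
abbrev U (n : ℕ) : Type := UniversalEnvelopingAlgebra ℂ (Affine n)

/-- The canonical map of the affine algebra to its universal enveloping algebra. -/
abbrev toU (n : ℕ) (x : Affine n) : U n := UniversalEnvelopingAlgebra.ι ℂ x

/-- The critical value `-h^∨ = -(2n - 2)` of `K`. -/
def critLevel (n : ℕ) : ℂ := -(2 * (n : ℂ) - 2)

/-! ### The vacuum module at the critical level and the Feigin--Frenkel center -/

/-- The left ideal of the enveloping algebra generated by `𝔬_{2n}[t]` and `K + 2n - 2`. -/
def vacuumIdeal (n : ℕ) : Ideal (U n) :=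
  Ideal.span ({u | ∃ (X : so2 n) (r : ℤ), 0 ≤ r ∧ u = toU n (loopElt n X r)} ∪
    {toU n (K n) - algebraMap ℂ (U n) (critLevel n)})

/-- The vacuum module at the critical level. -/
abbrev Vacuum (n : ℕ) : Type := U n ⧸ vacuumIdeal n

/-- The Feigin--Frenkel center: the vectors of the vacuum module annihilated by `𝔬_{2n}[t]`. -/
def ffCenter (n : ℕ) : Submodule ℂ (Vacuum n) where
  carrier := {v | ∀ (X : so2 n) (r : ℤ), 0 ≤ r → toU n (loopElt n X r) • v = 0}
  add_mem' {v w} hv hw X r hr := by rw [smul_add, hv X r hr, hw X r hr, add_zero]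
  zero_mem' X r _ := smul_zero _
  smul_mem' c v hv X r hr := by rw [smul_comm, hv X r hr, smul_zero]

/-! ### The completed enveloping algebra at the critical level -/

/-- The quotient of the enveloping algebra by the two-sided ideal generated by `K + 2n - 2`. -/
def UCrit (n : ℕ) : Type :=
  RingQuot fun a b : U n => a = toU n (K n) ∧ b = algebraMap ℂ (U n) (critLevel n)

instance (n : ℕ) : Ring (UCrit n) := inferInstanceAs (Ring (RingQuot _))

instance (n : ℕ) : Algebra ℂ (UCrit n) := inferInstanceAs (Algebra ℂ (RingQuot _))

/-- The quotient map. -/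
def toUCrit (n : ℕ) : U n →ₐ[ℂ] UCrit n := RingQuot.mkAlgHom ℂ _

/-- The left ideal of `UCrit n` generated by `t^N 𝔬_{2n}[t]`. -/
def leftIdeal (n : ℕ) (N : ℕ) : Ideal (UCrit n) :=
  Ideal.span {u | ∃ (X : so2 n) (r : ℤ), (N : ℤ) ≤ r ∧ u = toUCrit n (toU n (loopElt n X r))}

theorem leftIdeal_anti (n : ℕ) {M N : ℕ} (h : M ≤ N) : leftIdeal n N ≤ leftIdeal n M := by
  refine Ideal.span_mono ?_
  rintro u ⟨X, r, hr, rfl⟩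
  exact ⟨X, r, by omega, rfl⟩

theorem toUCrit_surjective (n : ℕ) : Function.Surjective (toUCrit n) :=
  RingQuot.mkAlgHom_surjective ℂ _

theorem toUCrit_K (n : ℕ) : toUCrit n (toU n (K n)) = algebraMap ℂ _ (critLevel n) := by
  have := RingQuot.mkAlgHom_rel ℂ
    (s := fun a b : U n => a = toU n (K n) ∧ b = algebraMap ℂ (U n) (critLevel n)) ⟨rfl, rfl⟩
  exact this.trans (AlgHom.commutes _ _)

/-- The elements whose right multiplication is continuous for the topology of the left ideals. -/
def goodElts (n : ℕ) : Subalgebra ℂ (UCrit n) where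
  carrier := {x | ∀ i, ∃ j, ∀ u ∈ leftIdeal n j, u * x ∈ leftIdeal n i}
  mul_mem' {x y} hx hy i := by
    obtain ⟨j, hj⟩ := hy i
    obtain ⟨k, hk⟩ := hx j
    exact ⟨k, fun u hu => by rw [← mul_assoc]; exact hj _ (hk u hu)⟩
  add_mem' {x y} hx hy i := by
    obtain ⟨j, hj⟩ := hx i
    obtain ⟨k, hk⟩ := hy i
    refine ⟨max j k, fun u hu => ?_⟩
    rw [mul_add]
    exact add_mem (hj u (leftIdeal_anti n (le_max_left _ _) hu))
      (hk u (leftIdeal_anti n (le_max_right _ _) hu))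
  algebraMap_mem' c i := ⟨i, fun u hu => by
    rw [← Algebra.commutes]
    exact Ideal.mul_mem_left _ _ hu⟩

theorem mem_goodElts_of_generators (n : ℕ) {x : UCrit n}
    (h : ∀ i, ∃ j : ℕ, ∀ (Y : so2 n) (s : ℤ), (j : ℤ) ≤ s →
      toUCrit n (toU n (loopElt n Y s)) * x ∈ leftIdeal n i) : x ∈ goodElts n := by
  intro i
  obtain ⟨j, hj⟩ := h i
  refine ⟨j, fun u hu => ?_⟩
  induction hu using Submodule.span_induction with
  | mem u hu =>
    obtain ⟨Y, s, hs, rfl⟩ := hu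
    exact hj Y s hs
  | zero => rw [zero_mul]; exact zero_mem _
  | add u v _ _ hu hv => rw [add_mul]; exact add_mem hu hv
  | smul a u _ hu => rw [smul_eq_mul, mul_assoc]; exact Ideal.mul_mem_left _ _ hu

theorem toU_lie (n : ℕ) (x y : Affine n) : toU n ⁅x, y⁆ = toU n x * toU n y - toU n y * toU n x := by
  rw [toU, LieHom.map_lie, LieRing.of_associative_ring_bracket]

theorem loopElt_mem_goodElts (n : ℕ) (X : so2 n) (r : ℤ) :
    toUCrit n (toU n (loopElt n X r)) ∈ goodElts n := by
  refine mem_goodElts_of_generators n fun i => ⟨i + r.natAbs + 1, fun Y s hs => ?_⟩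
  have h := toU_lie n (loopElt n Y s) (loopElt n X r)
  rw [affineLoop_lie, if_neg (by omega), zero_smul, add_zero, eq_sub_iff_add_eq] at h
  rw [← map_mul, ← h, map_add, map_mul]
  refine add_mem (Ideal.subset_span ⟨_, _, by omega, rfl⟩) (Ideal.mul_mem_left _ _ ?_)
  exact Ideal.subset_span ⟨_, _, by omega, rfl⟩

theorem toUCrit_toU_mem_goodElts (n : ℕ) (x : Affine n) : toUCrit n (toU n x) ∈ goodElts n := by
  induction x using affine_induction with
  | hK => rw [toUCrit_K]; exact Subalgebra.algebraMap_mem _ _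
  | hloop X r => exact loopElt_mem_goodElts n X r
  | hadd x y hx hy => rw [toU, map_add, map_add]; exact add_mem hx hy
  | hsmul c x hx => rw [toU, map_smul, map_smul]; exact Subalgebra.smul_mem _ hx c

theorem goodElts_eq_top (n : ℕ) (x : UCrit n) : x ∈ goodElts n := by
  obtain ⟨u, rfl⟩ := toUCrit_surjective n x
  let S : Subalgebra ℂ (U n) := (goodElts n).comap (toUCrit n)
  let f : Affine n →ₗ⁅ℂ⁆ S :=
    { toFun := fun x => ⟨toU n x, toUCrit_toU_mem_goodElts n x⟩
      map_add' := fun x y => Subtype.ext (map_add _ x y)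
      map_smul' := fun c x => Subtype.ext (map_smul _ c x)
      map_lie' := fun {x y} => Subtype.ext (toU_lie n x y) }
  have h : S.val.comp (UniversalEnvelopingAlgebra.lift ℂ f) = AlgHom.id ℂ (U n) := by
    ext x
    exact congrArg Subtype.val (UniversalEnvelopingAlgebra.lift_ι_apply ℂ f x)
  have h2 := DFunLike.congr_fun h u
  rw [AlgHom.id_apply] at h2
  rw [← h2]
  exact (UniversalEnvelopingAlgebra.lift ℂ f u).2

theorem leftIdeal_basis (n : ℕ) :
    RingSubgroupsBasis fun N : ℕ => (leftIdeal n N).toAddSubgroup where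
  inter i j := ⟨max i j, le_inf (leftIdeal_anti n (le_max_left _ _))
    (leftIdeal_anti n (le_max_right _ _))⟩
  mul i := ⟨i, by
    rintro _ ⟨x, _, y, hy, rfl⟩
    exact Ideal.mul_mem_left _ _ hy⟩
  leftMul x i := ⟨i, fun y hy => Ideal.mul_mem_left _ _ hy⟩
  rightMul x i := goodElts_eq_top n x i

/-- The linear topology of `UCrit n` whose basic neighbourhoods of zero are the left ideals
generated by `t^N 𝔬_{2n}[t]`, `N ≥ 0`. -/
instance (n : ℕ) : TopologicalSpace (UCrit n) := (leftIdeal_basis n).topology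

instance (n : ℕ) : IsTopologicalRing (UCrit n) :=
  (leftIdeal_basis n).toRingFilterBasis.isTopologicalRing

instance (n : ℕ) : UniformSpace (UCrit n) := IsTopologicalAddGroup.rightUniformSpace (UCrit n)

instance (n : ℕ) : IsUniformAddGroup (UCrit n) := isUniformAddGroup_of_addCommGroup

instance (n : ℕ) : UniformContinuousConstSMul ℂ (UCrit n) :=
  ⟨fun c => by
    simp only [Algebra.smul_def]
    exact uniformContinuous_addMonoidHom_of_continuous
      (f := AddMonoidHom.mulLeft (algebraMap ℂ (UCrit n) c)) (continuous_const_mul _)⟩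

/-- The completed universal enveloping algebra at the critical level: the (Hausdorff) completion of
`UCrit n`, that is, the inverse limit of the quotients `UCrit n ⧸ leftIdeal n N`. -/
abbrev CompletedU (n : ℕ) : Type := UniformSpace.Completion (UCrit n)

/-- The canonical map of the affine algebra to the completed enveloping algebra. -/
def toCompletedU (n : ℕ) (x : Affine n) : CompletedU n := ↑(toUCrit n (toU n x))

/-! ### Pfaffians -/

/-- The sum `1/(2^n n!) ∑_σ sgn σ • T(σ)` over the permutations `σ` of `2n` indices. -/
def pfSum {A : Type*} [AddCommGroup A] [Module ℂ A] (n : ℕ)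
    (T : Equiv.Perm (Fin (2 * n)) → A) : A :=
  (1 / (2 ^ n * (n.factorial : ℂ))) •
    ∑ σ : Equiv.Perm (Fin (2 * n)), ((Equiv.Perm.sign σ : ℤ) : ℂ) • T σ

/-- The `k`-th matrix entry `M_{σ(2k-1) σ(2k)}` in the Pfaffian (with `k` and the indices counted
from zero). -/
def pfEntry {B : Type*} {n : ℕ} (M : Fin (2 * n) → Fin (2 * n) → B)
    (σ : Equiv.Perm (Fin (2 * n))) (k : Fin n) : B :=
  M (σ ⟨2 * k, by omega⟩) (σ ⟨2 * k + 1, by omega⟩)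

/-- The Pfaffian `1/(2^n n!) ∑_σ sgn σ • M_{σ(1) σ(2)} ⋯ M_{σ(2n-1) σ(2n)}` of a `2n × 2n` matrix
over a `ℂ`-algebra, the factors being multiplied in this order. -/
def pfaffian {A : Type*} [Ring A] [Algebra ℂ A] (n : ℕ) (M : Fin (2 * n) → Fin (2 * n) → A) : A :=
  pfSum n fun σ => (List.ofFn (pfEntry M σ)).prod

/-! A two-sided formal series `a(z) = ∑_{r ∈ ℤ} a_r z^{-r-1}` over `A` is given by the function
`r ↦ a_r`. -/

/-- The tuples `(r_1, …, r_n)` with `z^{-r_1-1} ⋯ z^{-r_n-1} = z^{-p-1}`. -/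
abbrev Exponents (n : ℕ) (p : ℤ) : Type := {r : Fin n → ℤ // ∑ k, (-r k - 1) = -p - 1}

/-- The term `a_1[r_1] ⋯ a_n[r_n]` of the product of the series `a_1(z), …, a_n(z)`. -/
def productTerm {A : Type*} [Ring A] {n : ℕ} (a : Fin n → ℤ → A) (p : ℤ) (r : Exponents n p) : A :=
  (List.ofFn fun k => a k (r.1 k)).prod

/-- The coefficient of `z^{-p-1}` in the product `a_1(z) ⋯ a_n(z)` over a topological ring. -/
def productCoeff {A : Type*} [Ring A] [TopologicalSpace A] {n : ℕ} (a : Fin n → ℤ → A) (p : ℤ) :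
    A :=
  ∑' r : Exponents n p, productTerm a p r

/-- The series `F_{ij}(z) = ∑_{r ∈ ℤ} F_{ij}[r] z^{-r-1}`. -/
def Ffield (n : ℕ) (i j : Fin (2 * n)) : ℤ → CompletedU n :=
  fun r => toCompletedU n (loopElt n (Fmat n i j) r)

/-- The coefficient `S_p` of `z^{-p-1}` in the Pfaffian of the matrix `[F_{ij}(z)]`. -/
def S (n : ℕ) (p : ℤ) : CompletedU n :=
  pfSum n fun σ => productCoeff (pfEntry (Ffield n) σ) p

/-- The power series `F_{ij}(z)_+ = ∑_{r < 0} F_{ij}[r] z^{-r-1}` over the enveloping algebra. -/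
def FfieldPlus (n : ℕ) (i j : Fin (2 * n)) : PowerSeries (U n) :=
  PowerSeries.mk fun m => toU n (loopElt n (Fmat n i j) (-(m : ℤ) - 1))

/-- The coefficient `S⁺_p` of `z^{-p-1}` in the Pfaffian of the matrix `[F_{ij}(z)_+]`, for
`p < 0`. -/
def SPlus (n : ℕ) (p : ℤ) : U n :=
  PowerSeries.coeff (-p - 1).toNat (pfaffian n (FfieldPlus n))

end PfaffianSugawara

end

noncomputable section

namespace PfaffianSugawara

open LieAlgebra Filter Topology
open scoped TensorProduct

attribute [local instance] LieRing.ofAssociativeRing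

/-! ### Brackets and form values in the orthogonal Lie algebra -/

/-! Fix `i ≠ j` and expand the bracket of `F_ij[r]` with `S_p` over permutations. If `i` and `j`
share a block, `F_ij[r]` commutes with all factors but one, and only the central term survives:
`(2n-2) r` times the product with that factor erased (`lie_productCoeff_of_partner`).

Otherwise let `a`, `b` be the block neighbours of `i`, `j`. For commuting entries `σ` and `(i j) σ`
would cancel. Here the difference of their brackets is, up to sign, a sum over `s` of `g(s) -
g(s+r)` with `g(s) = (F_ja[s] F_jb[Q-s] + F_ia[s] F_ib[Q-s]) R` (`lie_pfTerm_sub`). It telescopes,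
and only the limits of `g` matter: `0` at `-∞`, but `-2 F_ab[Q] R` at `+∞`, where the factors must
first be exchanged. The anomaly (`lie_productCoeff_sub`) is an erased product for a permutation in
which `i` and `j` do share a block. Each such permutation arises `2n-2` times, with the opposite
sign (`signedSum_compl_sameBlock`), so at the critical level both contributions cancel
(`signedSum_eq_zero`).

For the vacuum module, let `J` be the left ideal generated by `𝔬_{2n}[t]`. A product with a
nonnegative mode lies in `J`, because that factor can be moved to the right end; hence `S_p` and
`S⁺_p` agree modulo the closure of `J` (`S_sub_mem`). As `X[r] S_p = S_p X[r]`, the closure also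
contains `X[r] S⁺_p` for `r ≥ 0`. Being open, `J` is closed, so `X[r] S⁺_p` is in `J` already before
completion. -/

theorem Fmat_swap (n : ℕ) (i j : Fin (2 * n)) : Fmat n j i = -Fmat n i j := by
  apply toMat_injective
  rw [map_neg, toMat_Fmat, toMat_Fmat, neg_sub]

theorem lie_Fmat_of_disjoint (n : ℕ) {i j k l : Fin (2 * n)} (hik : i ≠ k) (hil : i ≠ l)
    (hjk : j ≠ k) (hjl : j ≠ l) : ⁅Fmat n i j, Fmat n k l⁆ = 0 := by
  apply toMat_injective
  simp [toMat_lie, toMat_Fmat, mul_sub, sub_mul, hik, hil, hjk, hjl, hik.symm, hil.symm,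
    hjk.symm, hjl.symm]

theorem lie_Fmat_left (n : ℕ) {i j a : Fin (2 * n)} (hij : i ≠ j) (hia : i ≠ a) (hja : j ≠ a) :
    ⁅Fmat n i j, Fmat n i a⁆ = -Fmat n j a := by
  apply toMat_injective
  simp [toMat_lie, toMat_Fmat, mul_sub, sub_mul, hij, hia, hja, hij.symm, hia.symm, hja.symm]
  abel

theorem lie_Fmat_right (n : ℕ) {i j a : Fin (2 * n)} (hij : i ≠ j) (hia : i ≠ a) (hja : j ≠ a) :
    ⁅Fmat n i j, Fmat n j a⁆ = Fmat n i a := by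
  rw [Fmat_swap n j i, neg_lie, lie_Fmat_left n hij.symm hja hia, neg_neg]

theorem form_Fmat (n : ℕ) (i j k l : Fin (2 * n)) :
    form n (Fmat n i j) (Fmat n k l) =
      (if i = l ∧ j = k then 1 else 0) - (if i = k ∧ j = l then 1 else 0) := by
  simp only [form_apply, toMat_Fmat, mul_sub, sub_mul, Matrix.trace_sub]
  have h : ∀ a b c d : Fin (2 * n), Matrix.trace (Matrix.single a b (1 : ℂ) * Matrix.single c d 1) =
      if a = d ∧ b = c then 1 else 0 := by
    intro a b c d
    by_cases hbc : b = c
    · subst hbc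
      by_cases had : a = d
      · subst had
        simp
      · simp [had]
    · simp [hbc]
  simp only [h]
  have e1 : (i = k ∧ j = l) = (j = l ∧ i = k) := propext and_comm
  have e2 : (i = l ∧ j = k) = (j = k ∧ i = l) := propext and_comm
  simp only [e1, e2]
  ring

theorem form_Fmat_self (n : ℕ) {i j : Fin (2 * n)} (hij : i ≠ j) :
    form n (Fmat n i j) (Fmat n i j) = -1 := by
  simp [form_Fmat, hij]

theorem form_Fmat_of_ne (n : ℕ) {i j k l : Fin (2 * n)} (h1 : ¬(i = l ∧ j = k))
    (h2 : ¬(i = k ∧ j = l)) : form n (Fmat n i j) (Fmat n k l) = 0 := by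
  simp [form_Fmat, h1, h2]

/-- Averages the expansion of `X` in matrix units with its transpose; the factor `1/2` compensates
for counting both `(i, j)` and `(j, i)`. -/
theorem eq_sum_Fmat (n : ℕ) (X : so2 n) :
    X = ∑ i, ∑ j, ((1 / 2 : ℂ) * toMat n X i j) • Fmat n i j := by
  apply toMat_injective
  have hX : ∀ i j, toMat n X j i = -toMat n X i j := by
    intro i j
    have h : (toMat n X).transpose = -toMat n X :=
      (Orthogonal.mem_so (Fin (2 * n)) ℂ (toMat n X)).1 (Subtype.property X)
    exact congrFun (congrFun h i) j
  have h1 : toMat n X = ∑ i, ∑ j, Matrix.single i j (toMat n X i j) :=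
    Matrix.matrix_eq_sum_single _
  have h2 : toMat n X = -∑ i, ∑ j, Matrix.single j i (toMat n X i j) := by
    conv_lhs => rw [h1, Finset.sum_comm]
    rw [← Finset.sum_neg_distrib]
    refine Finset.sum_congr rfl fun i _ => ?_
    rw [← Finset.sum_neg_distrib]
    refine Finset.sum_congr rfl fun j _ => ?_
    rw [hX i j, ← Matrix.single_neg]
  have h3 : ∀ i j, toMat n (((1 / 2 : ℂ) * toMat n X i j) • Fmat n i j) =
      (1 / 2 : ℂ) • Matrix.single i j (toMat n X i j) -
        (1 / 2 : ℂ) • Matrix.single j i (toMat n X i j) := by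
    intro i j
    rw [map_smul, toMat_Fmat, smul_sub]
    simp
  simp only [map_sum, h3, Finset.sum_sub_distrib, ← Finset.smul_sum]
  rw [← h1, sub_eq_add_neg, ← smul_neg, ← h2, ← add_smul]
  norm_num

theorem loopElt_lie_of_disjoint (n : ℕ) {i j k l : Fin (2 * n)} (hik : i ≠ k) (hil : i ≠ l)
    (hjk : j ≠ k) (hjl : j ≠ l) (r s : ℤ) :
    ⁅loopElt n (Fmat n i j) r, loopElt n (Fmat n k l) s⁆ = 0 := by
  rw [affineLoop_lie, lie_Fmat_of_disjoint n hik hil hjk hjl,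
    form_Fmat_of_ne n (fun h => hil h.1) (fun h => hik h.1), affineLoop, TensorProduct.tmul_zero]
  have h0 : ((0 : loopAlgebra ℂ ℤ (so2 n)), (0 : ℂ)) = 0 := rfl
  rw [h0, map_zero]
  simp

/-! ### Loop generators in the critical quotient -/

theorem affineLoop_add {g : Type*} [LieRing g] [LieAlgebra ℂ g] (Φ : LinearMap.BilinForm ℂ g)
    (hi : Φ.lieInvariant g) (hs : Φ.IsSymm) (X Y : g) (r : ℤ) :
    affineLoop Φ hi hs (X + Y) r = affineLoop Φ hi hs X r + affineLoop Φ hi hs Y r := by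
  rw [affineLoop, affineLoop, affineLoop, ← map_add, TensorProduct.tmul_add, Prod.mk_add_mk,
    add_zero]

theorem affineLoop_smul {g : Type*} [LieRing g] [LieAlgebra ℂ g] (Φ : LinearMap.BilinForm ℂ g)
    (hi : Φ.lieInvariant g) (hs : Φ.IsSymm) (c : ℂ) (X : g) (r : ℤ) :
    affineLoop Φ hi hs (c • X) r = c • affineLoop Φ hi hs X r := by
  rw [affineLoop, affineLoop, ← map_smul, TensorProduct.tmul_smul, Prod.smul_mk, smul_zero]

/-- The image of `X[r]` in the critical quotient, as a linear map in `X`. -/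
def critLoop (n : ℕ) (r : ℤ) : so2 n →ₗ[ℂ] UCrit n where
  toFun X := toUCrit n (toU n (loopElt n X r))
  map_add' X Y := by
    rw [loopElt, affineLoop_add, toU, map_add, map_add]
  map_smul' c X := by
    rw [loopElt, affineLoop_smul, toU, map_smul, map_smul, RingHom.id_apply]

theorem critLoop_apply (n : ℕ) (X : so2 n) (r : ℤ) :
    critLoop n r X = toUCrit n (toU n (loopElt n X r)) := rfl

theorem critLoop_mul_sub (n : ℕ) (X Y : so2 n) (r s : ℤ) :
    critLoop n r X * critLoop n s Y - critLoop n s Y * critLoop n r X =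
      critLoop n (r + s) ⁅X, Y⁆ +
        algebraMap ℂ _ ((if r = -s then (r : ℂ) * form n X Y else 0) * critLevel n) := by
  simp only [critLoop_apply]
  rw [← map_mul (toUCrit n), ← map_mul (toUCrit n), ← map_sub (toUCrit n), ← toU_lie,
    affineLoop_lie, toU, map_add, map_add, map_smul,
    map_smul]
  rw [toUCrit_K, map_mul, ← Algebra.smul_def]

/-- The image of `F_{ij}[r]` in the critical quotient. -/
def critF (n : ℕ) (i j : Fin (2 * n)) (r : ℤ) : UCrit n := critLoop n r (Fmat n i j)

theorem critF_swap (n : ℕ) (i j : Fin (2 * n)) (r : ℤ) : critF n j i r = -critF n i j r := by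
  rw [critF, Fmat_swap, map_neg, critF]

theorem critF_commute (n : ℕ) {i j k l : Fin (2 * n)} (hik : i ≠ k) (hil : i ≠ l)
    (hjk : j ≠ k) (hjl : j ≠ l) (r s : ℤ) : Commute (critF n i j r) (critF n k l s) := by
  rw [Commute, SemiconjBy, ← sub_eq_zero, critF, critF, critLoop_apply, critLoop_apply,
    ← map_mul (toUCrit n), ← map_mul (toUCrit n), ← map_sub (toUCrit n), ← toU_lie, loopElt_lie_of_disjoint n hik hil hjk hjl, toU, map_zero,
    map_zero]

theorem critF_mul_sub_left (n : ℕ) {i j a : Fin (2 * n)} (hij : i ≠ j) (hia : i ≠ a) (hja : j ≠ a)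
    (r s : ℤ) : critF n i j r * critF n i a s - critF n i a s * critF n i j r =
      -critF n j a (r + s) := by
  rw [critF, critF, critLoop_mul_sub, lie_Fmat_left n hij hia hja, map_neg,
    form_Fmat_of_ne n (fun h => hia h.1) (fun h => hja h.2)]
  simp [critF]

theorem critF_mul_sub_right (n : ℕ) {i j a : Fin (2 * n)} (hij : i ≠ j) (hia : i ≠ a) (hja : j ≠ a)
    (r s : ℤ) : critF n i j r * critF n j a s - critF n j a s * critF n i j r =
      critF n i a (r + s) := by
  rw [critF, critF, critLoop_mul_sub, lie_Fmat_right n hij hia hja,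
    form_Fmat_of_ne n (fun h => hia h.1) (fun h => hij h.1)]
  simp [critF]

/-- The constant is the product of the form value `-1` and the level `-(2n-2)`. The numerical value
of the level enters the cancellation only here. -/
theorem critF_mul_sub_self (n : ℕ) {i j : Fin (2 * n)} (hij : i ≠ j) (r s : ℤ) :
    critF n i j r * critF n i j s - critF n i j s * critF n i j r =
      algebraMap ℂ _ (if s = -r then (2 * (n : ℂ) - 2) * r else 0) := by
  rw [critF, critF, critLoop_mul_sub, lie_self, map_zero, zero_add, form_Fmat_self n hij]
  by_cases h : s = -r
  · subst h
    simp only [neg_neg, if_true, critLevel]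
    congr 1
    ring
  · rw [if_neg h, if_neg (by omega), zero_mul]

theorem critLoop_mem_leftIdeal (n N : ℕ) (X : so2 n) {r : ℤ} (h : (N : ℤ) ≤ r) :
    critLoop n r X ∈ leftIdeal n N := Ideal.subset_span ⟨X, r, h, rfl⟩

/-! ### Ordered products of commuting factors -/

/-- Only the extracted factor has to commute with the others. Putting `1` in its place, rather than
shortening the list, keeps the index type fixed. -/
theorem prod_ofFn_eq_mul_update {A : Type*} [Monoid A] {n : ℕ} (f : Fin n → A) (k : Fin n)
    (h : ∀ m, m ≠ k → Commute (f k) (f m)) :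
    (List.ofFn f).prod = f k * (List.ofFn (Function.update f k 1)).prod := by
  induction n with
  | zero => exact k.elim0
  | succ n ih =>
    rw [List.ofFn_succ, List.prod_cons, List.ofFn_succ, List.prod_cons]
    refine Fin.cases ?_ (fun k => ?_) k (motive := fun k => (∀ m, m ≠ k → Commute (f k) (f m)) →
      f 0 * (List.ofFn fun i : Fin n => f i.succ).prod = f k * (Function.update f k 1 0 *
        (List.ofFn fun i : Fin n => Function.update f k 1 i.succ).prod)) h
    · intro _
      simp [Fin.succ_ne_zero]
    · intro h
      have h2 := ih (fun i => f i.succ) k fun m hm => h m.succ (by simpa using hm)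
      have h3 : (fun i : Fin n => Function.update f k.succ 1 i.succ) =
          Function.update (fun i : Fin n => f i.succ) k 1 := by
        ext i
        by_cases hi : i = k
        · subst hi; simp
        · simp [hi]
      rw [h2, h3, Function.update_of_ne (Fin.succ_ne_zero k).symm, ← mul_assoc, ← mul_assoc,
        (h 0 (Fin.succ_ne_zero k).symm).eq]

theorem commute_prod_ofFn {A : Type*} [Monoid A] {n : ℕ} (f : Fin n → A) (x : A)
    (h : ∀ m, Commute x (f m)) : Commute x (List.ofFn f).prod := by
  refine Commute.list_prod_right _ _ fun y hy => ?_
  obtain ⟨m, rfl⟩ := (List.mem_ofFn' _ _).1 hy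
  exact h m

theorem prod_ofFn_mem_leftIdeal (n N : ℕ) {m : ℕ} (f : Fin m → UCrit n) (k : Fin m)
    (h : ∀ l, l ≠ k → Commute (f k) (f l)) (hk : f k ∈ leftIdeal n N) :
    (List.ofFn f).prod ∈ leftIdeal n N := by
  rw [prod_ofFn_eq_mul_update f k h, (commute_prod_ofFn _ _ fun l => ?_).eq]
  · exact Ideal.mul_mem_left _ _ hk
  · by_cases hl : l = k
    · subst hl
      rw [Function.update_self]
      exact Commute.one_right _
    · rw [Function.update_of_ne hl]
      exact h l hl

/-! ### Blocks of positions -/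

/-- The block `{2k, 2k+1}` of a position. -/
def blk {n : ℕ} (q : Fin (2 * n)) : Fin n := ⟨q / 2, by omega⟩

/-- The other position of the same block. -/
def partner {n : ℕ} (q : Fin (2 * n)) : Fin (2 * n) :=
  ⟨if (q : ℕ) % 2 = 0 then q + 1 else q - 1, by split_ifs <;> omega⟩

/-- The sign that records whether a position is the first or the second of its block. -/
def orient {n : ℕ} (q : Fin (2 * n)) : ℂ := if (q : ℕ) % 2 = 0 then 1 else -1

theorem partner_ne {n : ℕ} (q : Fin (2 * n)) : partner q ≠ q := by
  rw [Ne, Fin.ext_iff, partner]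
  dsimp only
  split_ifs <;> omega

theorem blk_partner {n : ℕ} (q : Fin (2 * n)) : blk (partner q) = blk q := by
  rw [Fin.ext_iff, blk, blk, partner]
  dsimp only
  split_ifs <;> omega

theorem blk_eq_iff {n : ℕ} (q w : Fin (2 * n)) : blk w = blk q ↔ w = q ∨ w = partner q := by
  rw [Fin.ext_iff, Fin.ext_iff, Fin.ext_iff, blk, blk, partner]
  dsimp only
  split_ifs <;> omega

/-- Skew-symmetry lets either position of a block play the role of the first one, so later arguments
need no case split on parity. -/
theorem pfEntry_blk {n : ℕ} (σ : Equiv.Perm (Fin (2 * n))) (q : Fin (2 * n)) (s : ℤ) :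
    pfEntry (critF n) σ (blk q) s = orient q • critF n (σ q) (σ (partner q)) s := by
  rw [pfEntry, orient]
  split_ifs with h
  · have h1 : (⟨2 * (blk q : ℕ), by omega⟩ : Fin (2 * n)) = q := by
      simp only [Fin.ext_iff, blk]; omega
    have h2 : (⟨2 * (blk q : ℕ) + 1, by omega⟩ : Fin (2 * n)) = partner q := by
      simp only [Fin.ext_iff, blk, partner, if_pos h]; omega
    rw [h1, h2, one_smul]
  · have h1 : (⟨2 * (blk q : ℕ) + 1, by omega⟩ : Fin (2 * n)) = q := by
      simp only [Fin.ext_iff, blk]; omega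
    have h2 : (⟨2 * (blk q : ℕ), by omega⟩ : Fin (2 * n)) = partner q := by
      simp only [Fin.ext_iff, blk, partner, if_neg h]; omega
    rw [h1, h2, critF_swap, neg_one_smul]

theorem critF_commute_pfEntry {n : ℕ} (σ : Equiv.Perm (Fin (2 * n))) {p q : Fin (2 * n)}
    {m : Fin n} (hp : m ≠ blk p) (hq : m ≠ blk q) (r s : ℤ) :
    Commute (critF n (σ p) (σ q) r) (pfEntry (critF n) σ m s) := by
  refine critF_commute n ?_ ?_ ?_ ?_ r s <;>
  · rw [Ne, σ.apply_eq_iff_eq]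
    rintro rfl
    simp [blk, Fin.ext_iff] at hp hq
    try omega

theorem pfEntry_commute {n : ℕ} (σ : Equiv.Perm (Fin (2 * n))) {k m : Fin n} (h : m ≠ k)
    (r s : ℤ) : Commute (pfEntry (critF n) σ k r) (pfEntry (critF n) σ m s) := by
  rw [pfEntry]
  refine critF_commute_pfEntry σ ?_ ?_ r s <;>
  · simp only [blk, Ne, Fin.ext_iff] at h ⊢
    omega

theorem pfEntry_congr {n : ℕ} {σ σ' : Equiv.Perm (Fin (2 * n))} {m : Fin n}
    (h : ∀ p, blk p = m → σ p = σ' p) :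
    pfEntry (critF n) σ m = pfEntry (critF n) σ' m := by
  rw [pfEntry, pfEntry, h, h] <;>
  · simp only [blk, Fin.ext_iff]
    omega

/-! ### The terms of the Pfaffian and their brackets with the affine algebra -/

/-- The term `F_{σ(1) σ(2)}[e_1] ⋯ F_{σ(2n-1) σ(2n)}[e_n]`. -/
def pfTerm {n : ℕ} (σ : Equiv.Perm (Fin (2 * n))) (e : Fin n → ℤ) : UCrit n :=
  (List.ofFn fun m => pfEntry (critF n) σ m (e m)).prod

/-- The term `pfTerm σ e` with the `k`-th factor left out. -/
def pfTermErase {n : ℕ} (σ : Equiv.Perm (Fin (2 * n))) (e : Fin n → ℤ) (k : Fin n) : UCrit n :=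
  (List.ofFn (Function.update (fun m => pfEntry (critF n) σ m (e m)) k 1)).prod

/-- The term `pfTerm σ e` with the `k`-th and `l`-th factors left out. -/
def pfTermErase₂ {n : ℕ} (σ : Equiv.Perm (Fin (2 * n))) (e : Fin n → ℤ) (k l : Fin n) : UCrit n :=
  (List.ofFn (Function.update (Function.update (fun m => pfEntry (critF n) σ m (e m)) k 1) l 1)).prod

theorem pfTerm_eq {n : ℕ} (σ : Equiv.Perm (Fin (2 * n))) (e : Fin n → ℤ) (k : Fin n) :
    pfTerm σ e = pfEntry (critF n) σ k (e k) * pfTermErase σ e k :=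
  prod_ofFn_eq_mul_update _ k fun _ hm => pfEntry_commute σ hm _ _

theorem pfTermErase_eq {n : ℕ} (σ : Equiv.Perm (Fin (2 * n))) (e : Fin n → ℤ) {k l : Fin n}
    (h : l ≠ k) :
    pfTermErase σ e k = pfEntry (critF n) σ l (e l) * pfTermErase₂ σ e k l := by
  refine (prod_ofFn_eq_mul_update _ l fun m hm => ?_).trans ?_
  · rw [Function.update_of_ne h]
    by_cases hmk : m = k
    · subst hmk
      rw [Function.update_self]
      exact Commute.one_right _
    · rw [Function.update_of_ne hmk]
      exact pfEntry_commute σ hm _ _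
  · rw [Function.update_of_ne h]
    rfl

theorem critF_commute_pfTermErase₂ {n : ℕ} (σ : Equiv.Perm (Fin (2 * n))) (e : Fin n → ℤ)
    {p q : Fin (2 * n)} {k l : Fin n} (hp : blk p = k ∨ blk p = l) (hq : blk q = k ∨ blk q = l)
    (r : ℤ) : Commute (critF n (σ p) (σ q) r) (pfTermErase₂ σ e k l) := by
  refine commute_prod_ofFn _ _ fun m => ?_
  by_cases hl : m = l
  · subst hl
    rw [Function.update_self]
    exact Commute.one_right _
  by_cases hk : m = k
  · subst hk
    rw [Function.update_of_ne hl, Function.update_self]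
    exact Commute.one_right _
  rw [Function.update_of_ne hl, Function.update_of_ne hk]
  refine critF_commute_pfEntry σ ?_ ?_ _ _
  · rcases hp with rfl | rfl <;> assumption
  · rcases hq with rfl | rfl <;> assumption

theorem critF_commute_pfTermErase {n : ℕ} (σ : Equiv.Perm (Fin (2 * n))) (e : Fin n → ℤ)
    (q : Fin (2 * n)) (r : ℤ) :
    Commute (critF n (σ q) (σ (partner q)) r) (pfTermErase σ e (blk q)) := by
  have h := critF_commute_pfTermErase₂ σ e (k := blk q) (l := blk q) (Or.inl rfl)
    (Or.inl (blk_partner q)) r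
  rwa [pfTermErase₂, Function.update_idem] at h

theorem pfTermErase₂_congr {n : ℕ} {σ σ' : Equiv.Perm (Fin (2 * n))} {e e' : Fin n → ℤ}
    {k l : Fin n} (hσ : ∀ p, blk p ≠ k → blk p ≠ l → σ p = σ' p)
    (he : ∀ m, m ≠ k → m ≠ l → e m = e' m) : pfTermErase₂ σ e k l = pfTermErase₂ σ' e' k l := by
  rw [pfTermErase₂, pfTermErase₂]
  congr 2
  ext m : 1
  by_cases hl : m = l
  · subst hl
    simp
  by_cases hk : m = k
  · subst hk
    simp [hl]
  rw [Function.update_of_ne hl, Function.update_of_ne hk, Function.update_of_ne hl,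
    Function.update_of_ne hk, he m hk hl, pfEntry_congr fun p hp => ?_]
  subst hp
  exact hσ p hk hl

/-! ### Brackets of a loop generator with single Pfaffian terms -/

theorem lie_pfTerm_of_partner {n : ℕ} (σ : Equiv.Perm (Fin (2 * n))) (e : Fin n → ℤ)
    (q : Fin (2 * n)) (r : ℤ) :
    critF n (σ q) (σ (partner q)) r * pfTerm σ e - pfTerm σ e * critF n (σ q) (σ (partner q)) r =
      if e (blk q) = -r then
        (orient q * ((2 * (n : ℂ) - 2) * r)) • pfTermErase σ e (blk q) else 0 := by
  have hne : σ q ≠ σ (partner q) := fun h => partner_ne q (σ.injective h).symm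
  have h := critF_mul_sub_self n hne r (e (blk q))
  have hc := (critF_commute_pfTermErase σ e q r).eq
  rw [pfTerm_eq σ e (blk q), pfEntry_blk, smul_mul_assoc, mul_smul_comm, smul_mul_assoc, ← smul_sub,
    mul_assoc, ← hc, ← mul_assoc, ← mul_assoc, ← sub_mul, h, ← Algebra.smul_def, smul_smul]
  split_ifs <;> simp

/-- The sum of `F_{ja}[s] F_{jb}[Q-s]` and `F_{ia}[s] F_{ib}[Q-s]`. -/
def pairSum (n : ℕ) (i j a b : Fin (2 * n)) (Q s : ℤ) : UCrit n :=
  critF n j a s * critF n j b (Q - s) + critF n i a s * critF n i b (Q - s)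

/-- The limit `0` at `s → -∞`: the right-hand factors have large mode `Q - s` and move past `R`. -/
theorem pairSum_mul_mem_leftIdeal (n N : ℕ) {i j a b : Fin (2 * n)} {Q s : ℤ} {R : UCrit n}
    (hi : Commute (critF n i b (Q - s)) R) (hj : Commute (critF n j b (Q - s)) R)
    (h : s + N ≤ Q) : pairSum n i j a b Q s * R ∈ leftIdeal n N := by
  rw [pairSum, add_mul, mul_assoc, mul_assoc, hi.eq, hj.eq, ← mul_assoc, ← mul_assoc]
  exact add_mem (Ideal.mul_mem_left _ _ (critLoop_mem_leftIdeal n N _ (by omega)))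
    (Ideal.mul_mem_left _ _ (critLoop_mem_leftIdeal n N _ (by omega)))

/-- The limit at `s → +∞`: now the left-hand factors have large mode, and exchanging each pair costs
`-F_ab[Q]`, independent of `s`. The two summands give the coefficient `2`. -/
theorem pairSum_add_mul_mem_leftIdeal (n N : ℕ) {i j a b : Fin (2 * n)} (hia : i ≠ a) (hib : i ≠ b)
    (hja : j ≠ a) (hjb : j ≠ b) (hab : a ≠ b) {Q s : ℤ} {R : UCrit n}
    (hi : Commute (critF n i a s) R) (hj : Commute (critF n j a s) R)
    (h : (N : ℤ) ≤ s) :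
    pairSum n i j a b Q s * R + (2 : ℂ) • (critF n a b Q * R) ∈ leftIdeal n N := by
  have h1 := critF_mul_sub_left n hja hjb hab s (Q - s)
  have h2 := critF_mul_sub_left n hia hib hab s (Q - s)
  rw [add_sub_cancel, sub_eq_iff_eq_add] at h1 h2
  have h3 : pairSum n i j a b Q s * R + (2 : ℂ) • (critF n a b Q * R) =
      critF n j b (Q - s) * R * critF n j a s + critF n i b (Q - s) * R * critF n i a s := by
    rw [pairSum, h1, h2, two_smul, mul_assoc _ R, mul_assoc _ R, ← hi.eq, ← hj.eq]
    noncomm_ring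
  rw [h3]
  exact add_mem (Ideal.mul_mem_left _ _ (critLoop_mem_leftIdeal n N _ h))
    (Ideal.mul_mem_left _ _ (critLoop_mem_leftIdeal n N _ h))

theorem lie_mul_mul {A : Type*} [Ring A] {x u v R : A} (h : x * R = R * x) :
    x * (u * (v * R)) - u * (v * R) * x =
      (x * u - u * x) * v * R + u * (x * v - v * x) * R := by
  have : u * (v * R) * x = u * (v * (x * R)) := by rw [h]; noncomm_ring
  rw [this]
  noncomm_ring

/-- By the Leibniz rule each bracket has two terms, one per block touched. Of the four terms, two
carry the shift by `r` on the first factor and two on the second; they group into the values of one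
function at `e (blk q) + r` and at `e (blk q)`. -/
theorem lie_pfTerm_sub {n : ℕ} (σ : Equiv.Perm (Fin (2 * n))) (e : Fin n → ℤ)
    {q w : Fin (2 * n)} (hqw : blk w ≠ blk q) (r : ℤ) :
    (critF n (σ q) (σ w) r * pfTerm σ e - pfTerm σ e * critF n (σ q) (σ w) r) -
      (critF n (σ q) (σ w) r * pfTerm (Equiv.swap (σ q) (σ w) * σ) e -
        pfTerm (Equiv.swap (σ q) (σ w) * σ) e * critF n (σ q) (σ w) r) =
    (orient q * orient w) •
      (pairSum n (σ q) (σ w) (σ (partner q)) (σ (partner w)) (e (blk q) + e (blk w) + r)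
          (e (blk q)) * pfTermErase₂ σ e (blk q) (blk w) -
        pairSum n (σ q) (σ w) (σ (partner q)) (σ (partner w)) (e (blk q) + e (blk w) + r)
          (e (blk q) + r) * pfTermErase₂ σ e (blk q) (blk w)) := by
  have hij : q ≠ w := fun h => hqw (by rw [h])
  have hia : q ≠ partner q := (partner_ne q).symm
  have hjb : w ≠ partner w := (partner_ne w).symm
  have hib : q ≠ partner w := fun h => hqw (by rw [h, blk_partner])
  have hja : w ≠ partner q := fun h => hqw (by rw [h, blk_partner])
  set R := pfTermErase₂ σ e (blk q) (blk w) with hR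
  set τσ := Equiv.swap (σ q) (σ w) * σ with hτ
  have t1 : τσ q = σ w := by simp [hτ]
  have t2 : τσ w = σ q := by simp [hτ]
  have t0 : ∀ p, p ≠ q → p ≠ w → τσ p = σ p := by
    intro p h1 h2
    rw [hτ, Equiv.Perm.mul_apply]
    exact Equiv.swap_apply_of_ne_of_ne (fun h => h1 (σ.injective h)) fun h => h2 (σ.injective h)
  have hR' : pfTermErase₂ τσ e (blk q) (blk w) = R :=
    pfTermErase₂_congr (fun p h1 h2 => t0 p (fun h => h1 (by rw [h])) fun h => h2 (by rw [h]))
      fun _ _ _ => rfl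
  rw [pfTerm_eq σ e (blk q), pfTerm_eq τσ e (blk q), pfTermErase_eq σ e hqw,
    pfTermErase_eq τσ e hqw, hR', ← hR, pfEntry_blk, pfEntry_blk, pfEntry_blk, pfEntry_blk, t1, t2,
    t0 _ hia.symm hja.symm, t0 _ hib.symm hjb.symm]
  have hx := (critF_commute_pfTermErase₂ σ e (p := q) (q := w) (k := blk q) (l := blk w)
    (Or.inl rfl) (Or.inr rfl) r).eq
  rw [← hR] at hx
  have hσ := fun {p p' : Fin (2 * n)} (h : p ≠ p') => fun h' => h (σ.injective h')
  simp only [smul_mul_assoc, mul_smul_comm, smul_smul, ← smul_sub, mul_comm (orient w)]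
  rw [lie_mul_mul hx, lie_mul_mul hx,
    critF_mul_sub_left n (hσ hij) (hσ hia) (hσ hja),
    critF_mul_sub_left n (hσ hij) (hσ hib) (hσ hjb),
    critF_mul_sub_right n (hσ hij) (hσ hia) (hσ hja),
    critF_mul_sub_right n (hσ hij) (hσ hib) (hσ hjb), pairSum, pairSum]
  have e1 : e (blk q) + e (blk w) + r - e (blk q) = r + e (blk w) := by ring
  have e2 : e (blk q) + e (blk w) + r - (e (blk q) + r) = e (blk w) := by ring
  rw [e1, e2, add_comm (e (blk q)) r]
  congr 1
  noncomm_ring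

/-- Recognizes the boundary term `F_ab R`: the transposition brings `σ w` next to `σ q` and `σ
(partner q)` next to `σ (partner w)`. Erasing the block of `q` leaves the latter pair. -/
theorem pfTermErase_mul_swap {n : ℕ} (σ : Equiv.Perm (Fin (2 * n))) (e : Fin n → ℤ)
    {q w : Fin (2 * n)} (hqw : blk w ≠ blk q) :
    pfTermErase (σ * Equiv.swap (partner q) w) e (blk q) =
      orient w • (critF n (σ (partner q)) (σ (partner w)) (e (blk w)) *
        pfTermErase₂ σ e (blk q) (blk w)) := by
  have hR : pfTermErase₂ (σ * Equiv.swap (partner q) w) e (blk q) (blk w) =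
      pfTermErase₂ σ e (blk q) (blk w) := by
    refine pfTermErase₂_congr (fun p h1 h2 => ?_) fun _ _ _ => rfl
    rw [Equiv.Perm.mul_apply, Equiv.swap_apply_of_ne_of_ne]
    · rintro rfl
      exact h1 (blk_partner q)
    · rintro rfl
      exact h2 rfl
  rw [pfTermErase_eq _ e hqw, hR, pfEntry_blk, Equiv.Perm.mul_apply, Equiv.Perm.mul_apply,
    Equiv.swap_apply_right, Equiv.swap_apply_of_ne_of_ne, smul_mul_assoc]
  · exact fun h => hqw (by rw [← blk_partner w, h, blk_partner])
  · exact partner_ne w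

/-! ### Convergence in the completed enveloping algebra -/

instance (n : ℕ) : NonarchimedeanRing (UCrit n) := (leftIdeal_basis n).nonarchimedean

/-- The canonical ring homomorphism to the completed enveloping algebra. -/
def completedHom (n : ℕ) : UCrit n →+* CompletedU n := UniformSpace.Completion.coeRingHom

theorem completedHom_apply (n : ℕ) (u : UCrit n) : completedHom n u = (u : CompletedU n) := rfl

theorem continuous_completedHom (n : ℕ) : Continuous (completedHom n) :=
  UniformSpace.Completion.continuous_coe _

theorem completedHom_smul (n : ℕ) (c : ℂ) (u : UCrit n) :
    completedHom n (c • u) = c • completedHom n u :=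
  UniformSpace.Completion.coe_smul c u

theorem tendsto_completedHom_zero (n : ℕ) {ι : Type*} {l : Filter ι} {f : ι → UCrit n}
    (h : ∀ N, ∀ᶠ i in l, f i ∈ leftIdeal n N) :
    Tendsto (fun i => completedHom n (f i)) l (𝓝 0) := by
  have h1 : Tendsto f l (𝓝 0) :=
    (leftIdeal_basis n).hasBasis_nhds_zero.tendsto_right_iff.2 fun N _ => h N
  have h2 := ((continuous_completedHom n).tendsto 0).comp h1
  rwa [map_zero] at h2

/-! ### Telescoping in a complete nonarchimedean group -/

theorem hasSum_telescope {G : Type*} [AddCommGroup G] [UniformSpace G] [IsUniformAddGroup G]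
    [NonarchimedeanAddGroup G] [CompleteSpace G] [T2Space G] {g : ℤ → G} {a b : G}
    (ha : Tendsto g atBot (𝓝 a)) (hb : Tendsto g atTop (𝓝 b)) (r : ℤ) :
    HasSum (fun s => g (s + r) - g s) (r • (b - a)) := by
  have h1 : HasSum (fun s => g (s + 1) - g s) (b - a) := by
    -- Terms tending to `0` suffice for unconditional summability, so the sum may then be computed
    -- along the intervals `[-N, N)`.
    have hs : Summable fun s => g (s + 1) - g s := by
      refine NonarchimedeanAddGroup.summable_of_tendsto_cofinite_zero ?_
      rw [Int.cofinite_eq, tendsto_sup]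
      constructor
      · have := (ha.comp (tendsto_atBot_add_const_right _ (1 : ℤ) tendsto_id)).sub ha
        rwa [sub_self] at this
      · have := (hb.comp (tendsto_atTop_add_const_right _ (1 : ℤ) tendsto_id)).sub hb
        rwa [sub_self] at this
    have h2 : Tendsto (fun N : ℕ => Finset.Ico (-(N : ℤ)) N) atTop atTop := by
      refine tendsto_atTop_finset_of_monotone (fun N M h => ?_) fun x => ⟨x.natAbs + 1, ?_⟩
      · exact Finset.Ico_subset_Ico (by omega) (by omega)
      · rw [Finset.mem_Ico]
        omega
    have h3 : ∀ N : ℕ, ∑ s ∈ Finset.Ico (-(N : ℤ)) N, (g (s + 1) - g s) = g N - g (-N) := by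
      intro N
      have : ∀ M : ℕ, ∑ s ∈ Finset.Ico (-(N : ℤ)) (-N + M), (g (s + 1) - g s) =
          g (-N + M) - g (-N) := by
        intro M
        induction M with
        | zero => simp
        | succ M ih =>
          have : Finset.Ico (-(N : ℤ)) (-N + (M + 1 : ℕ)) =
              insert (-(N : ℤ) + M) (Finset.Ico (-(N : ℤ)) (-N + M)) := by
            ext x
            simp only [Finset.mem_insert, Finset.mem_Ico]
            push_cast
            omega
          rw [this, Finset.sum_insert (by simp), ih]
          push_cast
          rw [← add_assoc]
          abel
      have h := this (2 * N)
      have e : -(N : ℤ) + (2 * N : ℕ) = N := by push_cast; ring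
      rwa [e] at h
    have h4 := hs.hasSum.comp h2
    have h5 : Tendsto (fun N : ℕ => g N - g (-N)) atTop (𝓝 (b - a)) :=
      (hb.comp tendsto_natCast_atTop_atTop).sub
        (ha.comp (tendsto_neg_atTop_atBot.comp tendsto_natCast_atTop_atTop))
    have h6 := tendsto_nhds_unique (h4.congr h3) h5
    rw [← h6]
    exact hs.hasSum
  -- A shift by `r` is a sum of `r` unit shifts (or their negatives), and translating the index
  -- leaves each sum unchanged.
  induction r with
  | zero => simp
  | succ r ih =>
    have h2 := ((Equiv.addRight (r : ℤ)).hasSum_iff.2 h1).add ih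
    convert h2 using 1
    · ext s
      simp [add_assoc]
    · rw [add_smul, one_smul, add_comm]
  | pred r ih =>
    have h2 := ih.sub ((Equiv.addRight (-(r : ℤ) - 1)).hasSum_iff.2 h1)
    convert h2 using 1
    · ext s
      have e : s + (-(r : ℤ) - 1) + 1 = s + -r := by ring
      simp [e]
    · rw [sub_smul, one_smul]

/-! ### Summability of the product series and reparametrized exponents -/

theorem finite_exponents_lt (n : ℕ) (p : ℤ) (N : ℕ) :
    {e : Exponents n p | ∀ k, e.1 k < N}.Finite := by
  -- The exponents sum to `p + 1 - n`, so the nonnegative numbers `N - e_m` sum to `n N - (p + 1 -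
  -- n)`, which bounds each of them.
  refine ((Set.finite_Icc (fun _ : Fin n => (N : ℤ) - (n * N - (p + 1 - n)))
    fun _ => (N : ℤ)).preimage Subtype.val_injective.injOn).subset fun e he => ?_
  refine ⟨fun k => ?_, fun k => (he k).le⟩
  have h1 := Finset.single_le_sum (f := fun m => (N : ℤ) - e.1 m)
    (fun m _ => sub_nonneg.2 (he m).le) (Finset.mem_univ k)
  have h2 := e.2
  simp only [Finset.sum_sub_distrib, Finset.sum_neg_distrib, Finset.sum_const, Finset.card_univ,
    Fintype.card_fin, nsmul_eq_mul, mul_one] at h1 h2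
  dsimp only
  linarith

theorem productTerm_Ffield (n : ℕ) (σ : Equiv.Perm (Fin (2 * n))) (p : ℤ) (e : Exponents n p) :
    productTerm (pfEntry (Ffield n) σ) p e = completedHom n (pfTerm σ e.1) := by
  rw [productTerm, pfTerm, map_list_prod, List.map_ofFn]
  rfl

/-- All but finitely many tuples have an exponent at least `N`; the factors commute, so that one can
be put last. -/
theorem summable_productTerm (n : ℕ) (σ : Equiv.Perm (Fin (2 * n))) (p : ℤ) :
    Summable (productTerm (pfEntry (Ffield n) σ) p) := by
  refine NonarchimedeanAddGroup.summable_of_tendsto_cofinite_zero ?_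
  simp only [funext (productTerm_Ffield n σ p)]
  refine tendsto_completedHom_zero n fun N => ?_
  refine (finite_exponents_lt n p N).subset fun e he k => ?_
  by_contra hk
  exact he (prod_ofFn_mem_leftIdeal n N _ k (fun l hl => pfEntry_commute σ hl _ _)
    (critLoop_mem_leftIdeal n N _ (by omega)))

theorem hasSum_pfTerm (n : ℕ) (σ : Equiv.Perm (Fin (2 * n))) (p : ℤ) :
    HasSum (fun e : Exponents n p => completedHom n (pfTerm σ e.1))
      (productCoeff (pfEntry (Ffield n) σ) p) := by
  have h : HasSum (productTerm (pfEntry (Ffield n) σ) p) (productCoeff (pfEntry (Ffield n) σ) p) :=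
    (summable_productTerm n σ p).hasSum
  rwa [funext (productTerm_Ffield n σ p)] at h

theorem hasSum_lie_pfTerm (n : ℕ) (σ : Equiv.Perm (Fin (2 * n))) (p : ℤ) (x : UCrit n) :
    HasSum (fun e : Exponents n p => completedHom n (x * pfTerm σ e.1 - pfTerm σ e.1 * x))
      (completedHom n x * productCoeff (pfEntry (Ffield n) σ) p -
        productCoeff (pfEntry (Ffield n) σ) p * completedHom n x) := by
  have h := ((hasSum_pfTerm n σ p).mul_left (completedHom n x)).sub
    ((hasSum_pfTerm n σ p).mul_right (completedHom n x))
  simpa only [map_sub, map_mul] using h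

theorem sum_update_update {n : ℕ} (e : Fin n → ℤ) {k l : Fin n} (h : l ≠ k) (x y : ℤ) :
    ∑ m, (-(Function.update (Function.update e k x) l y) m - 1) =
      ∑ m, (-e m - 1) + (e k - x) + (e l - y) := by
  have h1 : ∀ (f : Fin n → ℤ) (j : Fin n) (z : ℤ), ∑ m, (-(Function.update f j z) m - 1) =
      ∑ m, (-f m - 1) + (f j - z) := by
    intro f j z
    rw [← Finset.add_sum_erase _ _ (Finset.mem_univ j),
      ← Finset.add_sum_erase _ (fun m => -f m - 1) (Finset.mem_univ j), Function.update_self,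
      Finset.sum_congr rfl fun m hm => by rw [Function.update_of_ne (Finset.ne_of_mem_erase hm)]]
    ring
  rw [h1, h1, Function.update_of_ne h]

/-- Exponents with given sum, parametrized by the exponent at `k` and the tuple in which the
exponents at `k` and `l` are replaced by `-r` and a complement. -/
def exponentsEquiv {n : ℕ} (p : ℤ) {k l : Fin n} (h : l ≠ k) (r : ℤ) :
    {e : Exponents n p // e.1 k = -r} × ℤ ≃ Exponents n p where
  toFun x := ⟨Function.update (Function.update x.1.1.1 k x.2) l (x.1.1.1 l - r - x.2), by
    rw [sum_update_update _ h, x.1.1.2, x.1.2]; ring⟩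
  -- The new exponent at `l` is the mode `Q` of the boundary term; the exponent `-r` at `k` belongs
  -- to the erased factor and restores the total.
  invFun e := (⟨⟨Function.update (Function.update e.1 k (-r)) l (e.1 k + e.1 l + r), by
    rw [sum_update_update _ h, e.2]; ring⟩, by simp [h.symm]⟩, e.1 k)
  left_inv x := by
    obtain ⟨⟨⟨e, he⟩, hk⟩, s⟩ := x
    dsimp only at hk
    refine Prod.ext (Subtype.ext (Subtype.ext (funext fun m => ?_))) ?_
    · by_cases hl : m = l
      · subst hl
        simp [h.symm]
      by_cases hm : m = k
      · subst hm
        simp [h.symm, hk]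
      simp [hl, hm]
    · simp [h.symm]
  right_inv e := by
    refine Subtype.ext (funext fun m => ?_)
    by_cases hl : m = l
    · subst hl
      simp
    by_cases hm : m = k
    · subst hm
      simp [h.symm]
    simp [hl, hm]

/-! ### Brackets of a loop generator with the product coefficients -/

/-- The coefficient of the product of the series `F_{σ(1) σ(2)}(z) ⋯ F_{σ(2n-1) σ(2n)}(z)` with
the factor of the position `q` left out, with a sign. -/
def erasedCoeff (n : ℕ) (p r : ℤ) (q : Fin (2 * n)) (σ : Equiv.Perm (Fin (2 * n))) :
    CompletedU n :=
  orient q • ∑' e : {e : Exponents n p // e.1 (blk q) = -r},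
    completedHom n (pfTermErase σ e.1.1 (blk q))

theorem lie_productCoeff_of_partner (n : ℕ) (p r : ℤ) (q : Fin (2 * n))
    (σ : Equiv.Perm (Fin (2 * n))) :
    completedHom n (critF n (σ q) (σ (partner q)) r) * productCoeff (pfEntry (Ffield n) σ) p -
      productCoeff (pfEntry (Ffield n) σ) p * completedHom n (critF n (σ q) (σ (partner q)) r) =
    ((2 * (n : ℂ) - 2) * r) • erasedCoeff n p r q σ := by
  have h := hasSum_lie_pfTerm n σ p (critF n (σ q) (σ (partner q)) r)
  simp only [lie_pfTerm_of_partner] at h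
  -- The central term vanishes unless the modes are opposite, which restricts the sum to this
  -- subtype.
  rw [← hasSum_subtype_iff_of_support_subset (s := {e : Exponents n p | e.1 (blk q) = -r})] at h
  · rw [← h.tsum_eq, erasedCoeff, smul_smul, ← tsum_const_smul'']
    refine tsum_congr fun e => ?_
    rw [Function.comp_apply, if_pos (show e.1.1 (blk q) = -r from e.2), completedHom_smul, mul_comm]
  · intro e he
    by_contra h1
    refine he ?_
    dsimp only
    rw [if_neg (show ¬e.1 (blk q) = -r from h1), map_zero]

theorem lie_productCoeff_sub (n : ℕ) (p r : ℤ) {q w : Fin (2 * n)} (hqw : blk w ≠ blk q)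
    (σ : Equiv.Perm (Fin (2 * n))) :
    (completedHom n (critF n (σ q) (σ w) r) * productCoeff (pfEntry (Ffield n) σ) p -
      productCoeff (pfEntry (Ffield n) σ) p * completedHom n (critF n (σ q) (σ w) r)) -
    (completedHom n (critF n (σ q) (σ w) r) *
        productCoeff (pfEntry (Ffield n) (Equiv.swap (σ q) (σ w) * σ)) p -
      productCoeff (pfEntry (Ffield n) (Equiv.swap (σ q) (σ w) * σ)) p *
        completedHom n (critF n (σ q) (σ w) r)) =
    (2 * (r : ℂ)) • erasedCoeff n p r q (σ * Equiv.swap (partner q) w) := by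
  have h := (hasSum_lie_pfTerm n σ p (critF n (σ q) (σ w) r)).sub
    (hasSum_lie_pfTerm n (Equiv.swap (σ q) (σ w) * σ) p (critF n (σ q) (σ w) r))
  simp only [← map_sub, lie_pfTerm_sub σ _ hqw] at h
  -- Sum first over `s` with the other exponents and `Q` fixed: each fibre telescopes to one erased
  -- term.
  have h2 := ((exponentsEquiv p hqw r).hasSum_iff.2 h).prod_fiberwise (g := fun e =>
    ((2 * (r : ℂ)) * orient q) •
      completedHom n (pfTermErase (σ * Equiv.swap (partner q) w) e.1.1 (blk q))) ?_
  · rw [← h2.tsum_eq, tsum_const_smul'', erasedCoeff, smul_smul]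
  rintro ⟨⟨e, he⟩, hk⟩
  dsimp only at hk
  have hia : q ≠ partner q := (partner_ne q).symm
  have hjb : w ≠ partner w := (partner_ne w).symm
  have hib : q ≠ partner w := fun h => hqw (by rw [h, blk_partner])
  have hja : w ≠ partner q := fun h => hqw (by rw [h, blk_partner])
  have hab : partner q ≠ partner w := fun h => hqw (by rw [← blk_partner w, ← h, blk_partner])
  set R := pfTermErase₂ σ e (blk q) (blk w) with hR
  have hR' : ∀ s : ℤ, pfTermErase₂ σ
      ((exponentsEquiv p hqw r (⟨⟨e, he⟩, hk⟩, s)).1) (blk q) (blk w) = R := by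
    intro s
    refine pfTermErase₂_congr (fun _ _ _ => rfl) fun m h1 h2 => ?_
    simp [exponentsEquiv, h1, h2]
  have ek : ∀ s : ℤ, (exponentsEquiv p hqw r (⟨⟨e, he⟩, hk⟩, s)).1 (blk q) = s := by
    intro s
    simp [exponentsEquiv, hqw.symm]
  have el : ∀ s : ℤ, (exponentsEquiv p hqw r (⟨⟨e, he⟩, hk⟩, s)).1 (blk w) =
      e (blk w) - r - s := by
    intro s
    simp [exponentsEquiv]
  have eQ : ∀ s : ℤ, s + (e (blk w) - r - s) + r = e (blk w) := fun s => by ring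
  simp only [Function.comp_apply, ek, el, hR', eQ]
  set g : ℤ → UCrit n := fun s => pairSum n (σ q) (σ w) (σ (partner q)) (σ (partner w))
    (e (blk w)) s * R with hg
  have hσ := fun {p p' : Fin (2 * n)} (h : p ≠ p') => fun h' => h (σ.injective h')
  have hc : ∀ p p' : Fin (2 * n), (blk p = blk q ∨ blk p = blk w) →
      (blk p' = blk q ∨ blk p' = blk w) → ∀ s, Commute (critF n (σ p) (σ p') s) R :=
    fun p p' h1 h2 s => critF_commute_pfTermErase₂ σ e h1 h2 s
  have ha : Tendsto (fun s => completedHom n (g s)) atBot (𝓝 0) := by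
    refine tendsto_completedHom_zero n fun N => ?_
    filter_upwards [eventually_le_atBot (e (blk w) - N)] with s hs
    exact pairSum_mul_mem_leftIdeal n N
      (hc _ _ (Or.inl rfl) (Or.inr (blk_partner w)) _)
      (hc _ _ (Or.inr rfl) (Or.inr (blk_partner w)) _) (by omega)
  have hb : Tendsto (fun s => completedHom n (g s)) atTop
      (𝓝 (-completedHom n ((2 : ℂ) • (critF n (σ (partner q)) (σ (partner w)) (e (blk w)) * R)))) := by
    have h1 : Tendsto (fun s => completedHom n
        (g s + (2 : ℂ) • (critF n (σ (partner q)) (σ (partner w)) (e (blk w)) * R)))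
        atTop (𝓝 0) := by
      refine tendsto_completedHom_zero n fun N => ?_
      filter_upwards [eventually_ge_atTop (N : ℤ)] with s hs
      exact pairSum_add_mul_mem_leftIdeal n N (hσ hia) (hσ hib) (hσ hja) (hσ hjb) (hσ hab)
        (hc _ _ (Or.inl rfl) (Or.inl (blk_partner q)) _)
        (hc _ _ (Or.inr rfl) (Or.inl (blk_partner q)) _) hs
    have h2 := h1.sub_const
      (completedHom n ((2 : ℂ) • (critF n (σ (partner q)) (σ (partner w)) (e (blk w)) * R)))
    rw [zero_sub] at h2
    exact h2.congr fun s => by rw [map_add, add_sub_cancel_right]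
  -- The minus sign is there because the summand is `g s - g (s + r)`, opposite to the order in
  -- `hasSum_telescope`.
  have ht := ((hasSum_telescope ha hb r).const_smul (-(orient q * orient w)))
  convert ht using 1
  · ext s
    rw [completedHom_smul, ← map_sub, neg_smul, ← smul_neg, ← map_neg, neg_sub]
  · rw [pfTermErase_mul_swap σ e hqw, ← hR, ← Int.cast_smul_eq_zsmul ℂ, sub_zero,
      completedHom_smul, completedHom_smul, ← neg_smul, smul_smul, smul_smul, smul_smul]
    congr 1
    ring

/-! ### The Sugawara operators -/

theorem partner_partner {n : ℕ} (q : Fin (2 * n)) : partner (partner q) = q := by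
  rw [Fin.ext_iff, partner, partner]
  dsimp only
  split_ifs <;> omega

/-- The signed sum of the values `T σ` over a set of permutations. -/
def signedSum {V : Type*} [AddCommGroup V] [Module ℂ V] {m : ℕ}
    (s : Finset (Equiv.Perm (Fin m))) (T : Equiv.Perm (Fin m) → V) : V :=
  ∑ σ ∈ s, ((Equiv.Perm.sign σ : ℤ) : ℂ) • T σ

/-- The permutations for which `i` and `j` occupy the same block. -/
def sameBlock {n : ℕ} (i j : Fin (2 * n)) : Finset (Equiv.Perm (Fin (2 * n))) :=
  Finset.univ.filter fun σ => σ⁻¹ j = partner (σ⁻¹ i)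

theorem mem_sameBlock {n : ℕ} {i j : Fin (2 * n)} {σ : Equiv.Perm (Fin (2 * n))} :
    σ ∈ sameBlock i j ↔ σ⁻¹ j = partner (σ⁻¹ i) := by
  simp [sameBlock]

/-- The map sends a permutation separating `i` and `j` to one joining them, at the cost of a
transposition, hence the sign. It is undone by remembering the old position `w` of `j`, which can be
anything outside the block of `i`: `2n-2` choices. -/
theorem signedSum_compl_sameBlock {V : Type*} [AddCommGroup V] [Module ℂ V] {n : ℕ}
    {i j : Fin (2 * n)} (hij : i ≠ j) (E : Equiv.Perm (Fin (2 * n)) → V) :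
    signedSum (sameBlock i j)ᶜ (fun σ => E (σ * Equiv.swap (partner (σ⁻¹ i)) (σ⁻¹ j))) =
      -(2 * (n : ℂ) - 2) • signedSum (sameBlock i j) E := by
  have h1 : signedSum (sameBlock i j)ᶜ
      (fun σ => E (σ * Equiv.swap (partner (σ⁻¹ i)) (σ⁻¹ j))) =
      ∑ x ∈ (sameBlock i j).sigma fun σ => (Finset.univ.erase (σ⁻¹ i)).erase (partner (σ⁻¹ i)),
        (-((Equiv.Perm.sign x.1 : ℤ) : ℂ)) • E x.1 := by
    have key : ∀ (σ : Equiv.Perm (Fin (2 * n))) (w : Fin (2 * n)), w ≠ σ⁻¹ i →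
        (σ * Equiv.swap (partner (σ⁻¹ i)) w)⁻¹ i = σ⁻¹ i ∧
        (σ * Equiv.swap (partner (σ⁻¹ i)) w)⁻¹ j = Equiv.swap (partner (σ⁻¹ i)) w (σ⁻¹ j) := by
      intro σ w hw
      rw [mul_inv_rev, Equiv.swap_inv, Equiv.Perm.mul_apply, Equiv.Perm.mul_apply]
      exact ⟨Equiv.swap_apply_of_ne_of_ne (partner_ne _).symm hw.symm, rfl⟩
    have hne : ∀ σ : Equiv.Perm (Fin (2 * n)), σ⁻¹ j ≠ σ⁻¹ i := fun σ h =>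
      hij ((σ⁻¹).injective h).symm
    refine Finset.sum_bij' (fun σ _ => ⟨σ * Equiv.swap (partner (σ⁻¹ i)) (σ⁻¹ j), σ⁻¹ j⟩)
      (fun x _ => x.1 * Equiv.swap (partner (x.1⁻¹ i)) x.2) ?_ ?_ ?_ ?_ ?_
    · intro σ hσ
      rw [Finset.mem_compl, mem_sameBlock] at hσ
      obtain ⟨k1, k2⟩ := key σ _ (hne σ)
      simp only [Finset.mem_sigma, mem_sameBlock, Finset.mem_erase, Finset.mem_univ, and_true]
      rw [k1, k2, Equiv.swap_apply_right]
      exact ⟨rfl, hσ, hne σ⟩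
    · rintro ⟨σ, w⟩ hx
      simp only [Finset.mem_sigma, mem_sameBlock, Finset.mem_erase, Finset.mem_univ, and_true] at hx
      obtain ⟨k1, k2⟩ := key σ w hx.2.2
      rw [Finset.mem_compl, mem_sameBlock]
      dsimp only
      rw [k1, k2, hx.1, Equiv.swap_apply_left]
      exact hx.2.1
    · intro σ hσ
      obtain ⟨k1, k2⟩ := key σ _ (hne σ)
      dsimp only
      rw [k1, mul_assoc, Equiv.swap_mul_self, mul_one]
    · rintro ⟨σ, w⟩ hx
      simp only [Finset.mem_sigma, mem_sameBlock, Finset.mem_erase, Finset.mem_univ, and_true] at hx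
      obtain ⟨k1, k2⟩ := key σ w hx.2.2
      dsimp only
      rw [k1, k2, hx.1, Equiv.swap_apply_left, mul_assoc, Equiv.swap_mul_self, mul_one]
    · intro σ hσ
      rw [Finset.mem_compl, mem_sameBlock] at hσ
      dsimp only
      rw [Equiv.Perm.sign_mul, Equiv.Perm.sign_swap (Ne.symm hσ)]
      simp only [mul_neg, mul_one, Units.val_neg, Int.cast_neg, neg_neg]
  rw [h1, Finset.sum_sigma, signedSum, Finset.smul_sum]
  refine Finset.sum_congr rfl fun σ _ => ?_
  have hn : 1 ≤ n := by have := i.2; omega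
  dsimp only
  rw [Finset.sum_const, Finset.card_erase_of_mem
    (Finset.mem_erase.2 ⟨partner_ne _, Finset.mem_univ _⟩),
    Finset.card_erase_of_mem (Finset.mem_univ _), Finset.card_univ, Fintype.card_fin,
    ← Nat.cast_smul_eq_nsmul ℂ, smul_smul, smul_smul]
  congr 1
  rw [Nat.sub_sub, Nat.cast_sub (by omega)]
  push_cast
  ring

/-- Pure bookkeeping over permutations, free of convergence questions: `L` stands for the bracket
and `E` for the erased product. -/
theorem signedSum_eq_zero {V : Type*} [AddCommGroup V] [Module ℂ V] {n : ℕ} {i j : Fin (2 * n)}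
    (hij : i ≠ j) (r : ℂ) (L E : Equiv.Perm (Fin (2 * n)) → V)
    (hA : ∀ σ, σ⁻¹ j = partner (σ⁻¹ i) → L σ = ((2 * (n : ℂ) - 2) * r) • E σ)
    (hB : ∀ σ, σ⁻¹ j ≠ partner (σ⁻¹ i) → L σ - L (Equiv.swap i j * σ) =
      (2 * r) • E (σ * Equiv.swap (partner (σ⁻¹ i)) (σ⁻¹ j))) :
    signedSum Finset.univ L = 0 := by
  have h1 : signedSum (sameBlock i j) L =
      ((2 * (n : ℂ) - 2) * r) • signedSum (sameBlock i j) E := by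
    rw [signedSum, signedSum, Finset.smul_sum]
    refine Finset.sum_congr rfl fun σ hσ => ?_
    rw [hA σ (mem_sameBlock.1 hσ), smul_comm]
  -- Left multiplication by `(i j)` preserves the complement and flips signs, so the sum of
  -- differences is twice the sum of `L`; this turns `2 r` into `r`.
  have h2 : signedSum (sameBlock i j)ᶜ (fun σ => L (Equiv.swap i j * σ)) =
      -signedSum (sameBlock i j)ᶜ L := by
    have hm : ∀ σ ∈ (sameBlock i j)ᶜ, Equiv.swap i j * σ ∈ (sameBlock i j)ᶜ := by
      intro σ hσ
      rw [Finset.mem_compl, mem_sameBlock] at hσ ⊢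
      rw [mul_inv_rev, Equiv.swap_inv, Equiv.Perm.mul_apply, Equiv.Perm.mul_apply,
        Equiv.swap_apply_left, Equiv.swap_apply_right]
      intro h
      rw [h, partner_partner] at hσ
      exact hσ rfl
    rw [signedSum, signedSum, ← Finset.sum_neg_distrib]
    refine Finset.sum_bij' (fun σ _ => Equiv.swap i j * σ) (fun σ _ => Equiv.swap i j * σ)
      hm hm ?_ ?_ ?_
    · intro σ _
      rw [← mul_assoc, Equiv.swap_mul_self, one_mul]
    · intro σ _
      rw [← mul_assoc, Equiv.swap_mul_self, one_mul]
    · intro σ _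
      simp [Equiv.Perm.sign_swap hij]
  have h3 : signedSum (sameBlock i j)ᶜ L - signedSum (sameBlock i j)ᶜ
      (fun σ => L (Equiv.swap i j * σ)) = (2 * r) • (-(2 * (n : ℂ) - 2) •
        signedSum (sameBlock i j) E) := by
    rw [← signedSum_compl_sameBlock hij, signedSum, signedSum, signedSum, ← Finset.sum_sub_distrib,
      Finset.smul_sum]
    refine Finset.sum_congr rfl fun σ hσ => ?_
    rw [Finset.mem_compl, mem_sameBlock] at hσ
    rw [← smul_sub, hB σ hσ, smul_comm]
  rw [h2, sub_neg_eq_add, ← two_smul ℂ, mul_smul] at h3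
  have h4 := smul_right_injective V (two_ne_zero (α := ℂ)) h3
  have h5 : signedSum Finset.univ L = signedSum (sameBlock i j) L + signedSum (sameBlock i j)ᶜ L :=
    (Finset.sum_add_sum_compl _ _).symm
  rw [h5, h1, h4, smul_smul, ← add_smul]
  convert zero_smul ℂ _ using 2
  ring

theorem commute_S_critF (n : ℕ) (p r : ℤ) {i j : Fin (2 * n)} (hij : i ≠ j) :
    Commute (S n p) (completedHom n (critF n i j r)) := by
  have hinv : ∀ (σ : Equiv.Perm (Fin (2 * n))) k, σ (σ⁻¹ k) = k := fun σ k => σ.apply_symm_apply k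
  have h := signedSum_eq_zero hij (r : ℂ)
    (fun σ => completedHom n (critF n i j r) * productCoeff (pfEntry (Ffield n) σ) p -
      productCoeff (pfEntry (Ffield n) σ) p * completedHom n (critF n i j r))
    (fun σ => erasedCoeff n p r (σ⁻¹ i) σ) ?_ ?_
  · rw [S, pfSum]
    refine Commute.smul_left ?_ _
    rw [Commute, SemiconjBy, eq_comm, ← sub_eq_zero, Finset.mul_sum, Finset.sum_mul,
      ← Finset.sum_sub_distrib, ← h, signedSum]
    refine Finset.sum_congr rfl fun σ _ => ?_
    rw [mul_smul_comm, smul_mul_assoc, smul_sub]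
  · intro σ hσ
    have h := lie_productCoeff_of_partner n p r (σ⁻¹ i) σ
    rwa [← hσ, hinv, hinv] at h
  · intro σ hσ
    have hne : σ⁻¹ j ≠ σ⁻¹ i := fun h => hij ((σ⁻¹).injective h).symm
    have h := lie_productCoeff_sub n p r (q := σ⁻¹ i) (w := σ⁻¹ j)
      (fun h => ((blk_eq_iff _ _).1 h).elim hne hσ) σ
    rw [hinv, hinv] at h
    have hq : (σ * Equiv.swap (partner (σ⁻¹ i)) (σ⁻¹ j))⁻¹ i = σ⁻¹ i := by
      rw [mul_inv_rev, Equiv.swap_inv, Equiv.Perm.mul_apply]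
      exact Equiv.swap_apply_of_ne_of_ne (partner_ne _).symm hne.symm
    rw [h, hq]

theorem commute_S (n : ℕ) (p : ℤ) (x : Affine n) : Commute (S n p) (toCompletedU n x) := by
  have hadd : ∀ x y, toCompletedU n (x + y) = toCompletedU n x + toCompletedU n y := by
    intro x y
    simp only [toCompletedU, toU, ← completedHom_apply, map_add]
  have hsmul : ∀ (c : ℂ) x, toCompletedU n (c • x) = c • toCompletedU n x := by
    intro c x
    simp only [toCompletedU, toU, ← completedHom_apply, map_smul, completedHom_smul]
  induction x using affine_induction with
  | hK =>
    have h : toCompletedU n (K n) = critLevel n • 1 := by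
      rw [toCompletedU, toUCrit_K, Algebra.algebraMap_eq_smul_one, ← completedHom_apply,
        completedHom_smul, map_one]
    rw [h]
    exact (Commute.one_right _).smul_right _
  | hloop X r =>
    have h : toCompletedU n (loopElt n X r) = completedHom n (critLoop n r X) := rfl
    rw [h, eq_sum_Fmat n X]
    simp only [map_sum, map_smul, completedHom_smul]
    refine Commute.sum_right _ _ _ fun i _ => Commute.sum_right _ _ _ fun j _ => ?_
    refine Commute.smul_right ?_ _
    by_cases hij : i = j
    · subst hij
      have h0 : Fmat n i i = 0 := by
        apply toMat_injective
        rw [toMat_Fmat, sub_self, map_zero]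
      rw [h0, map_zero, map_zero]
      exact Commute.zero_right _
    · exact commute_S_critF n p r hij
  | hadd x y hx hy => rw [hadd]; exact hx.add_right hy
  | hsmul c x hx => rw [hsmul]; exact hx.smul_right c

/-! ### The vacuum module as a module over the critical quotient -/

theorem commute_toU_K (n : ℕ) (u : U n) : Commute (toU n (K n)) u := by
  let C : Subalgebra ℂ (U n) := Subalgebra.centralizer ℂ {toU n (K n)}
  have hC : ∀ x, toU n x ∈ C := by
    intro x
    rw [Subalgebra.mem_centralizer_iff]
    rintro _ rfl
    rw [← sub_eq_zero, ← toU_lie, affineK_lie, toU, map_zero]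
  let f : Affine n →ₗ⁅ℂ⁆ C :=
    { toFun := fun x => ⟨toU n x, hC x⟩
      map_add' := fun x y => Subtype.ext (map_add _ x y)
      map_smul' := fun c x => Subtype.ext (map_smul _ c x)
      map_lie' := fun {x y} => Subtype.ext (toU_lie n x y) }
  have h : C.val.comp (UniversalEnvelopingAlgebra.lift ℂ f) = AlgHom.id ℂ (U n) := by
    ext x
    exact congrArg Subtype.val (UniversalEnvelopingAlgebra.lift_ι_apply ℂ f x)
  have h2 : (UniversalEnvelopingAlgebra.lift ℂ f u : U n) = u := DFunLike.congr_fun h u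
  have h3 := (UniversalEnvelopingAlgebra.lift ℂ f u).2
  rw [h2] at h3
  exact (Subalgebra.mem_centralizer_iff ℂ).1 h3 _ rfl

theorem K_smul_vacuum (n : ℕ) (v : Vacuum n) :
    toU n (K n) • v = algebraMap ℂ (U n) (critLevel n) • v := by
  obtain ⟨u, rfl⟩ := Submodule.Quotient.mk_surjective _ v
  rw [← Submodule.Quotient.mk_smul, ← Submodule.Quotient.mk_smul, Submodule.Quotient.eq, smul_eq_mul,
    smul_eq_mul, (commute_toU_K n u).eq, Algebra.commutes, ← mul_sub]
  exact Ideal.mul_mem_left _ _ (Ideal.subset_span (Or.inr rfl))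

/-- The action of the critical quotient on the vacuum module. -/
def vacuumAction (n : ℕ) : UCrit n →ₐ[ℂ] Module.End ℂ (Vacuum n) :=
  RingQuot.liftAlgHom ℂ ⟨Algebra.lsmul ℂ ℂ (Vacuum n), by
    rintro _ _ ⟨rfl, rfl⟩
    exact LinearMap.ext (K_smul_vacuum n)⟩

theorem vacuumAction_apply (n : ℕ) (u : U n) (v : Vacuum n) :
    vacuumAction n (toUCrit n u) v = u • v := by
  rw [vacuumAction, toUCrit]
  exact LinearMap.congr_fun (RingQuot.liftAlgHom_mkAlgHom_apply ℂ _ _ u) v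

theorem mem_vacuumIdeal_of_toUCrit_mem (n : ℕ) {u : U n} (h : toUCrit n u ∈ leftIdeal n 0) :
    u ∈ vacuumIdeal n := by
  have h1 : ∀ a ∈ leftIdeal n 0, vacuumAction n a (Submodule.Quotient.mk 1) = 0 := by
    intro a ha
    induction ha using Submodule.span_induction with
    | mem a ha =>
      obtain ⟨X, r, hr, rfl⟩ := ha
      rw [vacuumAction_apply, ← Submodule.Quotient.mk_smul, smul_eq_mul, mul_one,
        Submodule.Quotient.mk_eq_zero]
      exact Ideal.subset_span (Or.inl ⟨X, r, hr, rfl⟩)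
    | zero => rw [map_zero, LinearMap.zero_apply]
    | add a b _ _ ha hb => rw [map_add, LinearMap.add_apply, ha, hb, add_zero]
    | smul c a _ ha => rw [smul_eq_mul, map_mul, Module.End.mul_apply, ha, map_zero]
  have h2 := h1 _ h
  rwa [vacuumAction_apply, ← Submodule.Quotient.mk_smul, smul_eq_mul, mul_one,
    Submodule.Quotient.mk_eq_zero] at h2

/-! ### The vectors of the Feigin--Frenkel center -/

/-- The closure of the left ideal generated by `𝔬_{2n}[t]` in the completed algebra. -/
def closedLeftIdeal (n : ℕ) : AddSubgroup (CompletedU n) :=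
  ((leftIdeal n 0).toAddSubgroup.map (completedHom n).toAddMonoidHom).topologicalClosure

theorem mem_closedLeftIdeal_iff (n : ℕ) {x : CompletedU n} : x ∈ closedLeftIdeal n ↔
    x ∈ closure (completedHom n '' (leftIdeal n 0 : Set (UCrit n))) := Iff.rfl

theorem isClosed_closedLeftIdeal (n : ℕ) : IsClosed (closedLeftIdeal n : Set (CompletedU n)) :=
  AddSubgroup.isClosed_topologicalClosure _

theorem completedHom_mem_closedLeftIdeal (n : ℕ) {u : UCrit n} (h : u ∈ leftIdeal n 0) :
    completedHom n u ∈ closedLeftIdeal n := subset_closure ⟨u, h, rfl⟩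

theorem mul_mem_closedLeftIdeal (n : ℕ) (a : CompletedU n) {x : CompletedU n}
    (h : x ∈ closedLeftIdeal n) : a * x ∈ closedLeftIdeal n := by
  rw [mem_closedLeftIdeal_iff] at h ⊢
  refine map_mem_closure₂ (f := fun a x : CompletedU n => a * x) continuous_mul
    (UniformSpace.Completion.denseRange_coe a) h ?_
  rintro _ ⟨b, rfl⟩ _ ⟨u, hu, rfl⟩
  exact ⟨b * u, Ideal.mul_mem_left _ _ hu, map_mul (completedHom n) b u⟩

theorem smul_mem_closedLeftIdeal (n : ℕ) (c : ℂ) {x : CompletedU n}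
    (h : x ∈ closedLeftIdeal n) : c • x ∈ closedLeftIdeal n := by
  have := mul_mem_closedLeftIdeal n (c • 1) h
  rwa [smul_mul_assoc, one_mul] at this

theorem mem_leftIdeal_of_completedHom_mem (n : ℕ) {u : UCrit n}
    (h : completedHom n u ∈ closedLeftIdeal n) : u ∈ leftIdeal n 0 := by
  have h1 : u ∈ closure (leftIdeal n 0 : Set (UCrit n)) := by
    rw [(UniformSpace.Completion.isUniformInducing_coe
      (UCrit n)).isInducing.closure_eq_preimage_closure_image]
    exact h
  have h2 : IsClosed ((leftIdeal n 0).toAddSubgroup : Set (UCrit n)) := by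
    refine AddSubgroup.isClosed_of_isOpen _ (AddSubgroup.isOpen_of_mem_nhds _ (g := 0) ?_)
    exact (leftIdeal_basis n).hasBasis_nhds_zero.mem_of_mem trivial
  exact h2.closure_eq.subset h1

theorem coeff_prod_ofFn_mk {R : Type*} [Semiring R] {n : ℕ} (a : Fin n → ℕ → R) (d : ℕ) :
    PowerSeries.coeff d (List.ofFn fun k => PowerSeries.mk (a k)).prod =
      ∑ t ∈ Finset.Nat.antidiagonalTuple n d, (List.ofFn fun k => a k (t k)).prod := by
  induction n generalizing d with
  | zero =>
    cases d with
    | zero => simp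
    | succ d => simp [PowerSeries.coeff_one]
  | succ n ih =>
    rw [List.ofFn_succ, List.prod_cons, PowerSeries.coeff_mul]
    simp only [ih, PowerSeries.coeff_mk, Finset.mul_sum]
    rw [Finset.sum_sigma']
    refine Finset.sum_bij' (fun x _ => Fin.cons x.1.1 x.2)
      (fun t _ => ⟨(t 0, ∑ k : Fin n, t k.succ), fun k => t k.succ⟩) ?_ ?_ ?_ ?_ ?_
    · rintro ⟨⟨p, q⟩, t⟩ h
      simp only [Finset.mem_sigma, Finset.Nat.mem_antidiagonalTuple] at h
      rw [Finset.Nat.mem_antidiagonalTuple, Fin.sum_univ_succ]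
      simp only [Fin.cons_zero, Fin.cons_succ]
      rw [h.2]
      exact Finset.HasAntidiagonal.mem_antidiagonal.1 h.1
    · intro t h
      rw [Finset.Nat.mem_antidiagonalTuple, Fin.sum_univ_succ] at h
      simp only [Finset.mem_sigma, Finset.Nat.mem_antidiagonalTuple]
      exact ⟨Finset.HasAntidiagonal.mem_antidiagonal.2 h, trivial⟩
    · rintro ⟨⟨p, q⟩, t⟩ h
      simp only [Finset.mem_sigma, Finset.Nat.mem_antidiagonalTuple] at h
      obtain ⟨-, rfl⟩ := h
      simp
    · intro t _
      exact Fin.cons_self_tail t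
    · rintro ⟨⟨p, q⟩, t⟩ _
      simp

theorem toUCrit_SPlus (n : ℕ) (p : ℤ) : toUCrit n (SPlus n p) = pfSum n fun σ =>
    ∑ t ∈ Finset.Nat.antidiagonalTuple n (-p - 1).toNat, pfTerm σ fun k => -(t k : ℤ) - 1 := by
  rw [SPlus, pfaffian, pfSum, pfSum, PowerSeries.coeff_smul, map_smul, map_sum, map_sum]
  congr 1
  refine Finset.sum_congr rfl fun σ _ => ?_
  rw [PowerSeries.coeff_smul, map_smul]
  congr 1
  refine (congrArg (toUCrit n) (coeff_prod_ofFn_mk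
    (fun k m => pfEntry (fun i j r => toU n (loopElt n (Fmat n i j) r)) σ k (-(m : ℤ) - 1)) _)).trans ?_
  rw [map_sum]
  refine Finset.sum_congr rfl fun t _ => ?_
  rw [map_list_prod, List.map_ofFn]
  rfl

theorem productCoeff_sub_mem (n : ℕ) {p : ℤ} (hp : p < 0) (σ : Equiv.Perm (Fin (2 * n))) :
    productCoeff (pfEntry (Ffield n) σ) p - completedHom n
      (∑ t ∈ Finset.Nat.antidiagonalTuple n (-p - 1).toNat, pfTerm σ fun k => -(t k : ℤ) - 1) ∈
      closedLeftIdeal n := by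
  classical
  set A := Finset.Nat.antidiagonalTuple n (-p - 1).toNat with hA
  have hmem : ∀ t : Fin n → ℕ, t ∈ A → ∑ k, (-(-(t k : ℤ) - 1) - 1) = -p - 1 := by
    intro t ht
    rw [hA, Finset.Nat.mem_antidiagonalTuple] at ht
    have h2 : ∑ k, (t k : ℤ) = -p - 1 := by
      rw [← Nat.cast_sum, ht]
      omega
    rw [← h2]
    exact Finset.sum_congr rfl fun k _ => by ring
  let B : Finset (Exponents n p) := A.attach.map
    ⟨fun t => ⟨fun k => -(t.1 k : ℤ) - 1, hmem t.1 t.2⟩, fun t t' h => Subtype.ext (funext fun k => by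
      have := congrFun (congrArg Subtype.val h) k
      dsimp only at this
      omega)⟩
  have h1 : completedHom n (∑ t ∈ A, pfTerm σ fun k => -(t k : ℤ) - 1) =
      ∑ e ∈ B, completedHom n (pfTerm σ e.1) := by
    rw [Finset.sum_map, ← Finset.sum_attach, map_sum]
    rfl
  have h2 := (hasSum_pfTerm n σ p).summable.sum_add_tsum_compl (s := B)
  rw [(hasSum_pfTerm n σ p).tsum_eq] at h2
  rw [h1, ← h2, add_sub_cancel_left]
  refine (isClosed_closedLeftIdeal n).mem_of_tendsto
    ((hasSum_pfTerm n σ p).summable.subtype _).hasSum (Eventually.of_forall fun s => ?_)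
  refine AddSubgroup.sum_mem _ fun e _ => completedHom_mem_closedLeftIdeal n ?_
  obtain ⟨e, he⟩ := e
  have h3 : ∃ k, 0 ≤ e.1 k := by
    by_contra! h
    refine he (Finset.mem_coe.2 (Finset.mem_map.2 ⟨⟨fun k => (-e.1 k - 1).toNat, ?_⟩,
      Finset.mem_attach _ _, Subtype.ext (funext fun k => ?_)⟩))
    · rw [hA, Finset.Nat.mem_antidiagonalTuple]
      zify
      rw [Int.toNat_of_nonneg (by omega)]
      refine Eq.trans ?_ e.2
      refine Finset.sum_congr rfl fun k _ => ?_
      have := h k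
      rw [Int.toNat_of_nonneg (by omega)]
    · have := h k
      change -((-e.1 k - 1).toNat : ℤ) - 1 = e.1 k
      omega
  obtain ⟨k, hk⟩ := h3
  exact prod_ofFn_mem_leftIdeal n 0 _ k (fun l hl => pfEntry_commute σ hl _ _)
    (critLoop_mem_leftIdeal n 0 _ hk)

theorem S_sub_mem (n : ℕ) {p : ℤ} (hp : p < 0) :
    S n p - completedHom n (toUCrit n (SPlus n p)) ∈ closedLeftIdeal n := by
  rw [toUCrit_SPlus, S, pfSum, pfSum, completedHom_smul, ← smul_sub, map_sum,
    ← Finset.sum_sub_distrib]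
  refine smul_mem_closedLeftIdeal n _ (AddSubgroup.sum_mem _ fun σ _ => ?_)
  rw [completedHom_smul, ← smul_sub]
  exact smul_mem_closedLeftIdeal n _ (productCoeff_sub_mem n hp σ)

theorem SPlus_mem_ffCenter (n : ℕ) {p : ℤ} (hp : p < 0) :
    (Submodule.Quotient.mk (SPlus n p) : Vacuum n) ∈ ffCenter n := by
  intro X r hr
  rw [← Submodule.Quotient.mk_smul, Submodule.Quotient.mk_eq_zero, smul_eq_mul]
  refine mem_vacuumIdeal_of_toUCrit_mem n (mem_leftIdeal_of_completedHom_mem n ?_)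
  have h1 := mul_mem_closedLeftIdeal n (completedHom n (critLoop n r X)) (S_sub_mem n hp)
  have h2 := mul_mem_closedLeftIdeal n (S n p) (completedHom_mem_closedLeftIdeal n
    (critLoop_mem_leftIdeal n 0 X hr))
  have h3 : S n p * completedHom n (critLoop n r X) = completedHom n (critLoop n r X) * S n p :=
    commute_S n p (loopElt n X r)
  have h4 := sub_mem h2 h1
  rw [h3, ← mul_sub, sub_sub_cancel, ← map_mul] at h4
  rwa [map_mul]

end PfaffianSugawara

end

open PfaffianSugawara in
theorem mainTheorem2 (n : ℕ) :
    -- the factors of every term of the Pfaffian of `[F_{ij}(z)]` commute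
    (∀ i j k l : Fin (2 * n), i ≠ k → i ≠ l → j ≠ k → j ≠ l → ∀ r s : ℤ,
      ⁅loopElt n (Fmat n i j) r, loopElt n (Fmat n k l) s⁆ = 0) ∧
    -- the sums that define the coefficients `S_p` converge in the completed enveloping algebra
    (∀ (σ : Equiv.Perm (Fin (2 * n))) (p : ℤ),
      Summable (productTerm (pfEntry (Ffield n) σ) p)) ∧
    -- the coefficients `S_p` commute with the affine Kac--Moody algebra
    (∀ (p : ℤ) (x : Affine n), Commute (S n p) (toCompletedU n x)) ∧
    -- the coefficients `S⁺_p` lie in the Feigin--Frenkel center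
    (∀ p : ℤ, p < 0 → (Submodule.Quotient.mk (SPlus n p) : Vacuum n) ∈ ffCenter n) :=
  ⟨fun _ _ _ _ hik hil hjk hjl r s => loopElt_lie_of_disjoint n hik hil hjk hjl r s,
    fun σ p => summable_productTerm n σ p, fun p x => commute_S n p x,
    fun _ hp => SPlus_mem_ffCenter n hp⟩
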